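/- Let $M_1(\mathbb Z)$ be the set of probability distributions on $\mathbb Z$, and for $\nu\in M_1(\mathbb Z)$ with $\sum_z|z|\nu(z)<\infty$ write $d(\nu)=\sum_z z\,\nu(z)$. A cookie environment is an element $\omega=(\omega_{x,j})_{x\in\mathbb Z,\,j\ge1}$ of $\Omega=M_1(\mathbb Z)^{\mathbb Z\times\mathbb N}$. For a fixed $\omega$, the excited random walk $(X_n)_{n\ge0}$ in $\omega$ started at $0$ is the process whose law $P_\omega$ is given by $P_\omega(X_0=0)=1$ and $$P_\omega\big(X_{n+1}=X_n+z\mid X_0,\dots,X_n\big)=\omega_{X_n,L_n(X_n)}(z),\qquad L_n(y)=\#\{0\le k\le n: X_k=y\}.$$ Let $\eta$ be a probability measure on $\Omega$, and let $\mathbb P_\eta(\cdot)=\int P_\omega(\cdot)\,\eta(d\omega)$ be the averaged law of the walk. Assume the following. 1. Under $\eta$, the sequence $(\omega_x)_{x\in\mathbb Z}$, where $\omega_x=(\omega_{x,j})_{j\ge1}$, is stationary and ergodic. 2. There are $M\ge1$ and $\mu\in M_1(\mathbb Z)$, $\mu\ne\delta_0$ (the unit mass at $0$), with finite mean $d(\mu)=0$,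 such that for $\eta$-a.e. $\omega$ and all $x\in\mathbb Z$: $\omega_{x,j}$ has finite mean $d(\omega_{x,j})\ge0$ for $1\le j\le M$, and $\omega_{x,j}=\mu$ for $j>M$. 3. $\mu([-B,B])=1$ for some $B<\infty$, and the support of $\mu$ generates the additive group $\mathbb Z$. 4. $E_\eta\big[\sum_{j=1}^M\sum_{z\in\mathbb Z}|z|\,\omega_{0,j}(z)\big]<\infty$. Let $\delta=E_\eta\big[\sum_{j\ge1}d(\omega_{0,j})\big]$, let $\mathcal R$ be the event that the walk visits every $x\in\mathbb Z$ infinitely often, and let $\mathcal T_+=\{\lim_{n\to\infty}X_n=+\infty\}$. Then: 1. $\mathbb P_\eta(\mathcal R\cup\mathcal T_+)=1$. 2. If $\delta<1$, then $\mathbb P_\eta(\mathcal R)=1$. -/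

import Mathlib

open MeasureTheory ProbabilityTheory Filter
open scoped ENNReal

noncomputable section

namespace ExcitedWalk

/-- A cookie environment. `ω x j` is the step distribution used by the walk on its `(j+1)`-st visit
to the site `x`, that is, the stack of cookies at each site is indexed from `0`.
The space of environments carries the product of the (Giry) sigma-algebras on the space of
probability measures on `ℤ`, generated by the evaluation maps `μ ↦ μ A`. -/
abbrev CookieEnv : Type := ℤ → ℕ → ProbabilityMeasure ℤ

/-- The local time at `y` of a path `h` recorded at the times `0, …, n`: the number of
`k ≤ n` with `h k = y`. -/
def localTime {n : ℕ} (h : Finset.Iic n → ℤ) (y : ℤ) : ℕ :=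
  (Finset.univ.filter fun k : Finset.Iic n => h k = y).card

/-- The position at time `n` of a path recorded at the times `0, …, n`. -/
def current {n : ℕ} (h : Finset.Iic n → ℤ) : ℤ := h ⟨n, Finset.mem_Iic.2 le_rfl⟩

/-- The distribution of the next step, given the history `h` up to time `n`: if the present visit to
the current site is the `L`-th one (so that `L ≥ 1`), it is the `L`-th cookie at that site, which
has index `L - 1`. -/
def stepLaw (ω : CookieEnv) {n : ℕ} (h : Finset.Iic n → ℤ) : ProbabilityMeasure ℤ :=
  ω (current h) (localTime h (current h) - 1)

/-- The transition kernel from the history up to time `n` to the position at time `n + 1`: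
the law of `h n + Z`, where `Z` has law `stepLaw ω h`. -/
def stepKernel (ω : CookieEnv) (n : ℕ) : Kernel (Finset.Iic n → ℤ) ℤ where
  toFun h := (stepLaw ω h : Measure ℤ).map (fun z => current h + z)
  measurable' := Measurable.of_discrete

instance (ω : CookieEnv) (n : ℕ) : IsMarkovKernel (stepKernel ω n) :=
  ⟨fun _ => Measure.isProbabilityMeasure_map (Measurable.of_discrete).aemeasurable⟩

/-- The quenched law on paths `ℕ → ℤ` of the excited random walk in the environment `ω`, started
at `x`: the walk is at `x` at time `0` and moves according to the kernels `stepKernel ω n`. -/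
def quenchedLaw (ω : CookieEnv) (x : ℤ) : Measure (ℕ → ℤ) :=
  Kernel.traj (X := fun _ => ℤ) (stepKernel ω) 0 (fun _ => x)

instance (ω : CookieEnv) (x : ℤ) : IsProbabilityMeasure (quenchedLaw ω x) := by
  unfold quenchedLaw; infer_instance

/-- The averaged law of the walk started at `x`, when the environment has law `η`:
`A ↦ ∫ (quenchedLaw ω x) A dη(ω)`. -/
def averagedLaw (η : Measure CookieEnv) (x : ℤ) : Measure (ℕ → ℤ) :=
  η.bind fun ω => quenchedLaw ω x

lemma measurable_env_apply (x : ℤ) (j : ℕ) (s : Set ℤ) :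
    Measurable fun ω : CookieEnv => (ω x j : Measure ℤ) s := by
  have h1 : Measurable fun ω : CookieEnv => ω x j := by fun_prop
  exact (Measure.measurable_coe (MeasurableSet.of_discrete)).comp (measurable_subtype_coe.comp h1)

lemma measurable_stepKernel (n : ℕ) (h : Finset.Iic n → ℤ) :
    Measurable fun ω : CookieEnv => stepKernel ω n h := by
  refine Measure.measurable_of_measurable_coe _ fun s hs => ?_
  have : ∀ ω : CookieEnv, stepKernel ω n h s
      = (stepLaw ω h : Measure ℤ) ((fun z => current h + z) ⁻¹' s) := fun ω =>
    Measure.map_apply Measurable.of_discrete hs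
  simp_rw [this]
  exact measurable_env_apply _ _ _

lemma measurable_partialTraj (x : Finset.Iic 0 → ℤ) (b : ℕ) :
    Measurable fun ω : CookieEnv =>
      Kernel.partialTraj (X := fun _ => ℤ) (stepKernel ω) 0 b x := by
  induction b with
  | zero => simp only [Kernel.partialTraj_self]; exact measurable_const
  | succ b ih =>
    refine Measure.measurable_of_measurable_coe _ fun s hs => ?_
    have key : ∀ ω : CookieEnv,
        Kernel.partialTraj (X := fun _ => ℤ) (stepKernel ω) 0 (b + 1) x s
          = ∑' y, Kernel.partialTraj (X := fun _ => ℤ) (stepKernel ω) b (b + 1) y s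
              * Kernel.partialTraj (X := fun _ => ℤ) (stepKernel ω) 0 b x {y} := by
      intro ω
      rw [Kernel.partialTraj_succ_eq_comp (Nat.zero_le b), Kernel.comp_apply' _ _ _ hs,
        lintegral_countable']
    simp_rw [key]
    refine Measurable.tsum fun y => Measurable.mul ?_
      ((Measure.measurable_coe (measurableSet_singleton y)).comp ih)
    have e : ∀ ω : CookieEnv,
        Kernel.partialTraj (X := fun _ => ℤ) (stepKernel ω) b (b + 1) y s
          = stepKernel ω b y
              ((MeasurableEquiv.piSingleton (X := fun _ => ℤ) b) ⁻¹'
                (Prod.mk y ⁻¹' (IicProdIoc (X := fun _ => ℤ) b (b + 1) ⁻¹' s))) := by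
      intro ω
      have hm : Measurable (IicProdIoc (X := fun _ => ℤ) b (b + 1)) := measurable_IicProdIoc
      rw [Kernel.partialTraj_succ_self]
      refine (Kernel.map_apply' _ hm _ hs).trans ?_
      refine (Kernel.prod_apply' _ _ _ (hm hs)).trans ?_
      rw [Kernel.id_apply, lintegral_dirac]
      exact Kernel.map_apply' _ (MeasurableEquiv.measurable _) _ (measurable_prodMk_left (hm hs))
    simp_rw [e]
    exact (Measure.measurable_coe MeasurableSet.of_discrete).comp (measurable_stepKernel b y)

/-- The quenched law depends measurably on the environment, so that the mixture defining the
averaged law is the intended one. -/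
lemma measurable_quenchedLaw (x : ℤ) : Measurable fun ω : CookieEnv => quenchedLaw ω x := by
  refine Measurable.measure_of_isPiSystem_of_isProbabilityMeasure
    (generateFrom_measurableCylinders (α := fun _ : ℕ => ℤ)).symm
    isPiSystem_measurableCylinders fun t ht => ?_
  obtain ⟨N, S, mS, rfl⟩ : ∃ N S, MeasurableSet S ∧ t = cylinder (Finset.Iic N) S := by
    simpa [measurableCylinders_nat] using ht
  have e : ∀ ω : CookieEnv, quenchedLaw ω x (cylinder (Finset.Iic N) S)
      = Kernel.partialTraj (X := fun _ => ℤ) (stepKernel ω) 0 N (fun _ => x) S := by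
    intro ω
    rw [← Kernel.traj_map_frestrictLe_apply,
      Measure.map_apply (Preorder.measurable_frestrictLe N) mS]
    rfl
  simp_rw [e]
  exact (Measure.measurable_coe mS).comp (measurable_partialTraj _ N)

lemma averagedLaw_apply (η : Measure CookieEnv) (x : ℤ) {A : Set (ℕ → ℤ)} (hA : MeasurableSet A) :
    averagedLaw η x A = ∫⁻ ω, quenchedLaw ω x A ∂η :=
  Measure.bind_apply hA (measurable_quenchedLaw x).aemeasurable

/-- The mean `d(μ) = ∑ z, z μ(z)` of a probability measure on `ℤ`. -/
def drift (μ : ProbabilityMeasure ℤ) : ℝ := ∫ z : ℤ, (z : ℝ) ∂(μ : Measure ℤ)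

/-- `μ` has a finite mean, i.e. `∑ z, |z| μ(z) < ∞`. -/
def HasFiniteMean (μ : ProbabilityMeasure ℤ) : Prop :=
  Integrable (fun z : ℤ => (z : ℝ)) (μ : Measure ℤ)

/-- The probability measures on `ℤ` with mean zero. -/
def meanZero : Set (ProbabilityMeasure ℤ) := {μ | HasFiniteMean μ ∧ drift μ = 0}

/-- The probability measures on `ℤ` with non-negative finite mean. -/
def meanNonneg : Set (ProbabilityMeasure ℤ) := {μ | HasFiniteMean μ ∧ 0 ≤ drift μ}

/-- The environments whose first `M` cookies at every site have non-negative finite mean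
and all of whose further cookies are equal to `μ`. -/
def positiveEnv (M : ℕ) (μ : ProbabilityMeasure ℤ) : Set CookieEnv :=
  {ω | ∀ x : ℤ, (∀ j < M, ω x j ∈ meanNonneg) ∧ ∀ j, M ≤ j → ω x j = μ}

/-- The spatial shift of an environment. The sequence `(ω x)` indexed by the sites `x` is
stationary and ergodic under `η` when this map preserves `η` and is ergodic for it. -/
def shift (ω : CookieEnv) : CookieEnv := fun x => ω (x + 1)

/-- The expected total drift at a site, `δ(η) = E_η[∑ j, d(ω 0 j)]`. -/
def totalDrift (η : Measure CookieEnv) : ℝ := ∫ ω : CookieEnv, ∑' j : ℕ, drift (ω 0 j) ∂η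

/-- The paths that visit every site infinitely often. -/
def recurrent : Set (ℕ → ℤ) := {X | ∀ x : ℤ, {n : ℕ | X n = x}.Infinite}

/-- The paths that tend to `+∞`. -/
def transientRight : Set (ℕ → ℤ) := {X | Tendsto X atTop atTop}

end ExcitedWalk

end

/-! ### One-step formula for the quenched law, and bookkeeping of cookies. -/

namespace ExcitedWalk

/-! Everything quantitative rests on one optional-stopping inequality, `mul_measure_exits_le`. If a
step from a site of `I` raises the mean of a nonnegative function `u` by at most a cost attached to
the cookie in use, then `a` times the probability of leaving `I` through a set where `u ≥ a` is at
most the starting value of `u` plus the costs at the sites visited, because no cookie is used twice.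

Dichotomy. If some site is visited infinitely often, then so is every site: beyond the first `M`
cookies the steps have law `μ`, and mean zero puts both signs in its support, which therefore
generates `ℤ` even as a monoid. Otherwise the path leaves every bounded set. Jumps from the negative
to the nonnegative half-line made with law `μ` start within distance `B` of the origin, so they
stop; those made with the first `M` cookies stop by Borel–Cantelli and the first moment assumption.
Hence the path tends to `+∞` unless it is eventually negative and unbounded below. The latter has
probability zero: for `u x = (B - x)⁺` a nonnegative drift only helps, and the sole cost is the
overshoot of the origin (`excess`), whose mean at distance `k` tends to `0`. So the probability of
reaching `-K` before the nonnegative half-line tends to `0` (`ae_quenchedLaw_escapesLeft`).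

Recurrence for `δ < 1`. Let `p` be the averaged probability of being at `y` at time `N` and staying
nonnegative from then on. With `u x = (x + B)⁺`, the site `k` costs its total drift times the
quenched probability of visiting it before becoming negative, plus an excess that is negligible on
average. For large `k` such a visit almost forces the walk to stay nonnegative forever, so the
visiting probability may be replaced by one that does not depend on `k`. The mean ergodic theorem
then gives `p ≤ δ * p`, hence `p = 0` (`lintegral_quenchedLaw_staysRight`). Right transience is a
countable union of such events. -/

/-- The index of the cookie used by the path `X` for its step at time `n`. -/
def cookieIndex (X : ℕ → ℤ) (n : ℕ) : ℕ :=
  localTime (Preorder.frestrictLe (π := fun _ => ℤ) n X) (X n) - 1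

lemma lintegral_stepKernel (ω : CookieEnv) (n : ℕ) (h : Finset.Iic n → ℤ) (f : ℤ → ℝ≥0∞) :
    ∫⁻ y, f y ∂(stepKernel ω n h) = ∫⁻ z, f (current h + z) ∂(stepLaw ω h : Measure ℤ) :=
  lintegral_map (Measurable.of_discrete) (Measurable.of_discrete)

/-- The marginal of the trajectory measure on finitely many times is `Kernel.partialTraj`, from
which the last step kernel can be peeled off. Finite histories form a countable discrete space, so
`G` needs no measurability assumption. -/
lemma lintegral_quenchedLaw_succ (ω : CookieEnv) (x : ℤ) (n : ℕ)
    (G : (Finset.Iic n → ℤ) → ℤ → ℝ≥0∞) :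
    ∫⁻ X, G (Preorder.frestrictLe (π := fun _ => ℤ) n X) (X (n + 1)) ∂(quenchedLaw ω x) =
      ∫⁻ X, ∫⁻ z, G (Preorder.frestrictLe (π := fun _ => ℤ) n X) (X n + z)
        ∂(ω (X n) (cookieIndex X n) : Measure ℤ) ∂(quenchedLaw ω x) := by
  have h1 : ∀ (m : ℕ) (F : (Finset.Iic m → ℤ) → ℝ≥0∞),
      ∫⁻ X, F (Preorder.frestrictLe (π := fun _ => ℤ) m X) ∂(quenchedLaw ω x) =
      ∫⁻ h, F h ∂(Kernel.partialTraj (X := fun _ => ℤ) (stepKernel ω) 0 m (fun _ => x)) := by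
    intro m F
    rw [← Kernel.traj_map_frestrictLe_apply,
      lintegral_map (Measurable.of_discrete) (Preorder.measurable_frestrictLe m)]
    rfl
  let F : (Finset.Iic (n + 1) → ℤ) → ℝ≥0∞ := fun h =>
    G (fun i => h ⟨i.1, Finset.mem_Iic.2 ((Finset.mem_Iic.1 i.2).trans n.le_succ)⟩)
      (h ⟨n + 1, Finset.mem_Iic.2 le_rfl⟩)
  have hF : Measurable F := Measurable.of_discrete
  have h2 := h1 (n + 1) F
  have h3 := h1 n fun h => ∫⁻ z, G h (current h + z) ∂(stepLaw ω h : Measure ℤ)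
  refine h2.trans (Eq.trans ?_ h3.symm)
  rw [Kernel.partialTraj_succ_eq_comp (Nat.zero_le n), Kernel.lintegral_comp _ _ _ hF]
  refine lintegral_congr fun h => ?_
  rw [← lintegral_stepKernel, Kernel.partialTraj_succ_self]
  have hm : Measurable (IicProdIoc (X := fun _ => ℤ) n (n + 1)) := measurable_IicProdIoc
  refine (Kernel.lintegral_map _ hm _ hF).trans ?_
  refine (Kernel.lintegral_prod Kernel.id
    ((stepKernel ω n).map (MeasurableEquiv.piSingleton (X := fun _ => ℤ) n)) h
    (hF.comp hm)).trans ?_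
  rw [Kernel.id_apply, lintegral_dirac]
  refine (Kernel.lintegral_map _ (MeasurableEquiv.measurable _) _
    ((hF.comp hm).comp measurable_prodMk_left)).trans ?_
  refine lintegral_congr fun y => ?_
  refine congrArg₂ G (funext fun i => ?_) ?_
  · simp [IicProdIoc, Finset.mem_Iic.1 i.2]
  · simp [IicProdIoc, MeasurableEquiv.piSingleton]

/-- `f` depends only on the values of the path at the times `0, …, n`. -/
def DependsUpTo {β : Type*} (n : ℕ) (f : (ℕ → ℤ) → β) : Prop :=
  ∀ X Y : ℕ → ℤ, (∀ i ≤ n, X i = Y i) → f X = f Y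

/-- Extend a finite path by `0`. -/
def extendPath {n : ℕ} (h : Finset.Iic n → ℤ) : ℕ → ℤ := fun i =>
  if hi : i ≤ n then h ⟨i, Finset.mem_Iic.2 hi⟩ else 0

lemma DependsUpTo.eq_extendPath {β : Type*} {n : ℕ} {f : (ℕ → ℤ) → β} (hf : DependsUpTo n f)
    (X : ℕ → ℤ) : f (extendPath (Preorder.frestrictLe (π := fun _ => ℤ) n X)) = f X :=
  hf _ _ fun i hi => by simp [extendPath, hi]

lemma DependsUpTo.measurable {β : Type*} [MeasurableSpace β] {n : ℕ} {f : (ℕ → ℤ) → β}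
    (hf : DependsUpTo n f) : Measurable f := by
  have : f = (fun h => f (extendPath h)) ∘ Preorder.frestrictLe (π := fun _ => ℤ) n := by
    ext X
    exact (hf.eq_extendPath X).symm
  rw [this]
  exact Measurable.of_discrete.comp (Preorder.measurable_frestrictLe n)

lemma DependsUpTo.measurableSet {n : ℕ} {s : Set (ℕ → ℤ)} (hs : DependsUpTo n (· ∈ s)) :
    MeasurableSet s := hs.measurable.setOf

/-- Conditionally on the past, the next step has the law of the cookie in use. -/
lemma lintegral_next (ω : CookieEnv) (x : ℤ) (n : ℕ) (F : (ℕ → ℤ) → ℤ → ℝ≥0∞)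
    (hF : DependsUpTo n F) :
    ∫⁻ X, F X (X (n + 1)) ∂(quenchedLaw ω x) =
      ∫⁻ X, ∫⁻ z, F X (X n + z) ∂(ω (X n) (cookieIndex X n) : Measure ℤ) ∂(quenchedLaw ω x) := by
  have := lintegral_quenchedLaw_succ ω x n fun h => F (extendPath h)
  simpa only [hF.eq_extendPath] using this

lemma dependsUpTo_cookieIndex (n : ℕ) : DependsUpTo n fun X => cookieIndex X n := by
  intro X Y h
  have : Preorder.frestrictLe (π := fun _ => ℤ) n X = Preorder.frestrictLe (π := fun _ => ℤ) n Y := by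
    ext i
    exact h i.1 (Finset.mem_Iic.1 i.2)
  simp only [cookieIndex, this, h n le_rfl]

lemma cookieIndex_eq (X : ℕ → ℤ) (n : ℕ) :
    cookieIndex X n = ((Finset.range n).filter fun k => X k = X n).card := by
  have : localTime (Preorder.frestrictLe (π := fun _ => ℤ) n X) (X n)
      = ((Finset.range (n + 1)).filter fun k => X k = X n).card := by
    unfold localTime
    refine Finset.card_bij (fun k _ => k.1) ?_ ?_ ?_
    · rintro ⟨k, hk⟩ h
      simp only [Finset.mem_filter, Finset.mem_univ, true_and, Finset.mem_range] at h ⊢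
      exact ⟨Nat.lt_succ_of_le (Finset.mem_Iic.1 hk), h⟩
    · intro a _ b _ h
      exact Subtype.ext h
    · intro k hk
      simp only [Finset.mem_filter, Finset.mem_range] at hk
      exact ⟨⟨k, Finset.mem_Iic.2 (by omega)⟩,
        Finset.mem_filter.2 ⟨Finset.mem_univ _, hk.2⟩, rfl⟩
  rw [cookieIndex, this, Finset.range_add_one, Finset.filter_insert, if_pos rfl,
    Finset.card_insert_of_notMem (by simp)]
  rfl

/-- Every cookie is used at most once. -/
lemma injective_cookie (X : ℕ → ℤ) : Function.Injective fun n => (X n, cookieIndex X n) := by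
  have key : ∀ m n, m < n → X m = X n → cookieIndex X m < cookieIndex X n := by
    intro m n hmn h
    rw [cookieIndex_eq, cookieIndex_eq]
    refine Finset.card_lt_card ((Finset.ssubset_iff_of_subset ?_).2 ⟨m, ?_, ?_⟩)
    · intro k
      simp only [Finset.mem_filter, Finset.mem_range, h]
      exact fun hk => ⟨hk.1.trans hmn, hk.2⟩
    · simp [hmn, h]
    · simp
  intro m n h
  obtain ⟨h1, h2⟩ := Prod.mk.inj h
  rcases lt_trichotomy m n with h3 | h3 | h3
  · exact absurd h2 (key m n h3 h1).ne
  · exact h3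
  · exact absurd h2 (key n m h3 h1.symm).ne'

/-- This pathwise bound turns sums over time into sums over the environment; it is what makes all
later costs independent of how long the walk runs. -/
lemma tsum_cookie_le (X : ℕ → ℤ) (f : ℤ → ℕ → ℝ≥0∞) :
    ∑' n, f (X n) (cookieIndex X n) ≤ ∑' x, ∑' j, f x j := by
  rw [← ENNReal.tsum_prod]
  exact ENNReal.tsum_comp_le_tsum_of_injective (injective_cookie X) fun p => f p.1 p.2

/-- From some time on, the walk leaves a given site using only the cookies beyond the first `M`. -/
lemma eventually_le_cookieIndex (X : ℕ → ℤ) (x : ℤ) (M : ℕ) :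
    ∀ᶠ n in atTop, X n = x → M ≤ cookieIndex X n := by
  have hf : {n | X n = x ∧ cookieIndex X n < M}.Finite := by
    refine Set.Finite.of_finite_image (f := fun n => (X n, cookieIndex X n))
      (((Set.finite_singleton x).prod (Set.finite_Iio M)).subset ?_) (injective_cookie X).injOn
    rintro _ ⟨n, hn, rfl⟩
    exact ⟨hn.1, hn.2⟩
  filter_upwards [Nat.cofinite_eq_atTop ▸ hf.eventually_cofinite_notMem] with n hn hx
  by_contra hlt
  exact hn ⟨hx, not_le.1 hlt⟩

end ExcitedWalk

/-! ### Exit events and the Lyapunov function estimate. -/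

namespace ExcitedWalk

/-- The paths that are at `y` at time `N` and stay in `I` during the `k` following steps. -/
def staysIn (I : Set ℤ) (N : ℕ) (y : ℤ) (k : ℕ) : Set (ℕ → ℤ) :=
  {X | X N = y ∧ ∀ i ≤ k, X (N + i) ∈ I}

/-- The paths that are at `y` at time `N` and then visit `x` before leaving `I`. -/
def visits (I : Set ℤ) (N : ℕ) (y x : ℤ) : Set (ℕ → ℤ) :=
  {X | ∃ k, X ∈ staysIn I N y k ∧ X (N + k) = x}

/-- The paths that are at `y` at time `N` and then stay in `I` until they jump into `T`. -/
def exits (I T : Set ℤ) (N : ℕ) (y : ℤ) : Set (ℕ → ℤ) :=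
  {X | ∃ k, X ∈ staysIn I N y k ∧ X (N + k + 1) ∈ T}

lemma dependsUpTo_staysIn (I : Set ℤ) (N : ℕ) (y : ℤ) (k : ℕ) :
    DependsUpTo (N + k) (· ∈ staysIn I N y k) := by
  intro X Y h
  refine propext (and_congr (by rw [h N (by omega)]) (forall₂_congr fun i hi => ?_))
  rw [h (N + i) (by omega)]

lemma measurableSet_staysIn (I : Set ℤ) (N : ℕ) (y : ℤ) (k : ℕ) :
    MeasurableSet (staysIn I N y k) := (dependsUpTo_staysIn I N y k).measurableSet

lemma measurableSet_coord (n : ℕ) (s : Set ℤ) : MeasurableSet {X : ℕ → ℤ | X n ∈ s} :=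
  measurable_pi_apply n (MeasurableSet.of_discrete (s := s))

lemma measurableSet_visits (I : Set ℤ) (N : ℕ) (y x : ℤ) : MeasurableSet (visits I N y x) := by
  have : visits I N y x = ⋃ k, staysIn I N y k ∩ {X | X (N + k) ∈ ({x} : Set ℤ)} := by
    ext X; simp [visits]
  rw [this]
  exact MeasurableSet.iUnion fun k => (measurableSet_staysIn I N y k).inter (measurableSet_coord _ _)

lemma measurableSet_exits (I T : Set ℤ) (N : ℕ) (y : ℤ) : MeasurableSet (exits I T N y) := by
  have : exits I T N y = ⋃ k, staysIn I N y k ∩ {X | X (N + k + 1) ∈ T} := by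
    ext X; simp [exits]
  rw [this]
  exact MeasurableSet.iUnion fun k => (measurableSet_staysIn I N y k).inter (measurableSet_coord _ _)

/-- The first exit time after `N` is `N + k + 1`; it is not `N` itself because of `h0`. -/
lemma exists_staysIn_of_notMem {I : Set ℤ} {N : ℕ} {X : ℕ → ℤ} (h0 : X N ∈ I)
    (h : ∃ n ≥ N, X n ∉ I) : ∃ k, X ∈ staysIn I N (X N) k ∧ X (N + k + 1) ∉ I := by
  classical
  have h' : ∃ m, X (N + m) ∉ I := by
    obtain ⟨n, hn, hX⟩ := h
    exact ⟨n - N, by rwa [Nat.add_sub_cancel' hn]⟩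
  obtain ⟨k, hk⟩ : ∃ k, Nat.find h' = k + 1 :=
    Nat.exists_eq_succ_of_ne_zero fun h1 => by
      have := Nat.find_spec h'
      rw [h1] at this
      exact this h0
  refine ⟨k, ⟨rfl, fun i hi => not_not.1 (Nat.find_min h' (by omega))⟩, ?_⟩
  have := Nat.find_spec h'
  rwa [hk] at this

variable (ω : CookieEnv) (x₀ : ℤ)

/-- Each cookie is used at most once, so the costs paid along the path before leaving `I` are
bounded by the costs of the sites visited. -/
lemma tsum_lintegral_cookie_le (I : Set ℤ) (N : ℕ) (y : ℤ) (c : ℤ → ℕ → ℝ≥0∞) :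
    ∑' k, ∫⁻ X, (staysIn I N y k).indicator
        (fun X => c (X (N + k)) (cookieIndex X (N + k))) X ∂(quenchedLaw ω x₀)
      ≤ ∑' x, quenchedLaw ω x₀ (visits I N y x) * ∑' j, c x j := by
  have hm : ∀ k, Measurable fun X : ℕ → ℤ => (staysIn I N y k).indicator
      (fun X => c (X (N + k)) (cookieIndex X (N + k))) X := by
    intro k
    refine Measurable.indicator (DependsUpTo.measurable (n := N + k) fun X Y h => ?_)
      (measurableSet_staysIn I N y k)
    have := dependsUpTo_cookieIndex (N + k) X Y h
    simp only at this
    simp only [h _ le_rfl, this]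
  rw [← lintegral_tsum fun k => (hm k).aemeasurable]
  have hp : ∀ X : ℕ → ℤ, ∑' k, (staysIn I N y k).indicator
      (fun X => c (X (N + k)) (cookieIndex X (N + k))) X
      ≤ ∑' x, ∑' j, (visits I N y x).indicator (fun _ => c x j) X := by
    intro X
    refine le_trans ?_ (tsum_cookie_le X fun x j => (visits I N y x).indicator (fun _ => c x j) X)
    refine le_trans (ENNReal.tsum_le_tsum fun k => ?_) (ENNReal.tsum_comp_le_tsum_of_injective
      (add_right_injective N) fun n => (visits I N y (X n)).indicator
        (fun _ => c (X n) (cookieIndex X n)) X)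
    by_cases hX : X ∈ staysIn I N y k
    · have : X ∈ visits I N y (X (N + k)) := ⟨k, hX, rfl⟩
      simp [hX, this]
    · simp [hX]
  refine (lintegral_mono hp).trans (le_of_eq ?_)
  have hm2 : ∀ x j, Measurable fun X : ℕ → ℤ => (visits I N y x).indicator (fun _ => c x j) X :=
    fun x j => measurable_const.indicator (measurableSet_visits I N y x)
  rw [lintegral_tsum fun x => (Measurable.tsum fun j => hm2 x j).aemeasurable]
  refine tsum_congr fun x => ?_
  rw [lintegral_tsum fun j => (hm2 x j).aemeasurable, ← ENNReal.tsum_mul_left]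
  refine tsum_congr fun j => ?_
  rw [lintegral_indicator_const (measurableSet_visits I N y x), mul_comm]

/-- A Lyapunov function estimate for the probability to leave `I` through `T`. -/
lemma mul_measure_exits_le {I T : Set ℤ} (N : ℕ) (y : ℤ) {u : ℤ → ℝ≥0∞} {c : ℤ → ℕ → ℝ≥0∞}
    (hu : ∀ x ∈ I, ∀ j, ∫⁻ z, u (x + z) ∂(ω x j : Measure ℤ) ≤ u x + c x j)
    (hT : Disjoint T I) {a : ℝ≥0∞} (ha : ∀ x ∈ T, a ≤ u x) :
    a * quenchedLaw ω x₀ (exits I T N y)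
      ≤ u y + ∑' x, quenchedLaw ω x₀ (visits I N y x) * ∑' j, c x j := by
  set P := quenchedLaw ω x₀ with hP
  let A := staysIn I N y
  -- `e k` is the value of `u` collected on leaving `I` at step `k + 1`, `v k` the value still
  -- carried by a path inside `I`, and `w k` the cost of the cookie used at step `k + 1`.
  let e : ℕ → (ℕ → ℤ) → ℝ≥0∞ := fun k => (A k).indicator fun X => Iᶜ.indicator u (X (N + k + 1))
  let v : ℕ → (ℕ → ℤ) → ℝ≥0∞ := fun k => (A k).indicator fun X => u (X (N + k))
  let w : ℕ → (ℕ → ℤ) → ℝ≥0∞ := fun k =>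
    (A k).indicator fun X => c (X (N + k)) (cookieIndex X (N + k))
  have hA : ∀ k, MeasurableSet (A k) := measurableSet_staysIn I N y
  have hu' : ∀ (f : ℤ → ℝ≥0∞) n, Measurable fun X : ℕ → ℤ => f (X n) := fun f n =>
    (Measurable.of_discrete (f := f)).comp (measurable_pi_apply n)
  have hem : ∀ k, Measurable (e k) := fun k => (hu' _ _).indicator (hA k)
  have hvm : ∀ k, Measurable (v k) := fun k => (hu' _ _).indicator (hA k)
  have step : ∀ n, ∫⁻ X, e n X ∂P + ∫⁻ X, v (n + 1) X ∂P ≤ ∫⁻ X, v n X ∂P + ∫⁻ X, w n X ∂P := by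
    intro n
    rw [← lintegral_add_left (hem n), ← lintegral_add_left (hvm n)]
    have h1 : ∀ X, e n X + v (n + 1) X = (A n).indicator (fun X => u (X (N + n + 1))) X := by
      intro X
      by_cases hX : X ∈ A n
      · by_cases hI : X (N + n + 1) ∈ I
        · have : X ∈ A (n + 1) := ⟨hX.1, fun i hi => by
            rcases Nat.le_succ_iff.1 hi with h | rfl
            · exact hX.2 i h
            · exact hI⟩
          have hI' : X (N + (n + 1)) ∈ I := hI
          simp [e, v, hX, this, hI', add_assoc]
        · have : X ∉ A (n + 1) := fun h => hI (h.2 (n + 1) le_rfl)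
          simp [e, v, hX, this, hI]
      · have : X ∉ A (n + 1) := fun h => hX ⟨h.1, fun i hi => h.2 i (by omega)⟩
        simp [e, v, hX, this]
    simp_rw [h1]
    have h2 := lintegral_next ω x₀ (N + n) (fun X z => (A n).indicator (fun _ => u z) X) (by
      intro X Y h
      have := dependsUpTo_staysIn I N y n X Y h
      simp only [eq_iff_iff] at this
      ext z
      by_cases hY : Y ∈ A n
      · simp [hY, A, this.2 hY]
      · have hX : X ∉ A n := fun h => hY (this.1 h)
        simp [hY, hX])
    have h3 : ∀ X : ℕ → ℤ, (A n).indicator (fun X => u (X (N + n + 1))) X =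
        (A n).indicator (fun _ => u (X (N + n + 1))) X := fun X => by simp [Set.indicator]
    simp_rw [h3]
    rw [hP, h2]
    refine lintegral_mono fun X => ?_
    by_cases hX : X ∈ A n
    · simpa [v, w, hX] using hu _ (hX.2 n le_rfl) (cookieIndex X (N + n))
    · simp [hX]
  -- The one-step inequalities telescope; keeping everything as sums avoids subtraction in `ℝ≥0∞`.
  have hsum : ∀ n, ∑ k ∈ Finset.range n, ∫⁻ X, e k X ∂P + ∫⁻ X, v n X ∂P
      ≤ u y + ∑ k ∈ Finset.range n, ∫⁻ X, w k X ∂P := by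
    intro n
    induction n with
    | zero =>
      have : ∀ X, v 0 X ≤ u y := fun X => by
        by_cases hX : X ∈ A 0
        · simp [v, hX, hX.1]
        · simp [v, hX]
      simpa using lintegral_mono (μ := P) this
    | succ n ih =>
      rw [Finset.sum_range_succ, Finset.sum_range_succ, add_assoc]
      calc _ ≤ ∑ k ∈ Finset.range n, ∫⁻ X, e k X ∂P + (∫⁻ X, v n X ∂P + ∫⁻ X, w n X ∂P) := by
            exact add_le_add_right (step n) _
        _ ≤ _ := by
            rw [← add_assoc, ← add_assoc]
            gcongr
  have htsum : ∑' k, ∫⁻ X, e k X ∂P ≤ u y + ∑' k, ∫⁻ X, w k X ∂P := by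
    refine ENNReal.tsum_le_of_sum_range_le fun n => ?_
    exact le_self_add.trans ((hsum n).trans (by gcongr; exact ENNReal.sum_le_tsum _))
  refine le_trans ?_ (htsum.trans (by gcongr; exact tsum_lintegral_cookie_le ω x₀ I N y c))
  rw [← lintegral_tsum fun k => (hem k).aemeasurable,
    ← lintegral_indicator_const (measurableSet_exits I T N y)]
  refine lintegral_mono (Set.indicator_le fun X hX => ?_)
  obtain ⟨k, hk, hkT⟩ := hX
  refine le_trans ?_ (ENNReal.le_tsum k)
  have : X (N + k + 1) ∈ Iᶜ := fun h => hT.le_bot ⟨hkT, h⟩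
  simpa [e, A, hk, this] using ha _ hkT

/-- One-step formula for events. -/
lemma measure_inter_next (n : ℕ) {A : Set (ℕ → ℤ)} (hA : DependsUpTo n (· ∈ A))
    (s : ℤ → Set ℤ) :
    quenchedLaw ω x₀ {X | X ∈ A ∧ X (n + 1) - X n ∈ s (X n)} =
      ∫⁻ X, A.indicator
        (fun X => (ω (X n) (cookieIndex X n) : Measure ℤ) (s (X n))) X ∂(quenchedLaw ω x₀) := by
  classical
  have hm : MeasurableSet {X : ℕ → ℤ | X ∈ A ∧ X (n + 1) - X n ∈ s (X n)} := by
    refine DependsUpTo.measurableSet (n := n + 1) fun X Y h => ?_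
    have := hA X Y fun i hi => h i (by omega)
    simp only [eq_iff_iff] at this
    simp [this, h n, h (n + 1)]
  have h2 := lintegral_next ω x₀ n
    (fun X z => A.indicator (fun _ => (s (X n)).indicator 1 (z - X n)) X) (by
      intro X Y h
      have := hA X Y h
      simp only [eq_iff_iff] at this
      ext z
      simp [Set.indicator, this, h n le_rfl])
  rw [← lintegral_indicator_one hm]
  refine Eq.trans (lintegral_congr fun X => ?_) (h2.trans (lintegral_congr fun X => ?_))
  · by_cases hX : X ∈ A <;> simp [Set.indicator, hX]
  · by_cases hX : X ∈ A
    · simp only [hX, Set.indicator_of_mem, add_sub_cancel_left]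
      rw [lintegral_indicator_one MeasurableSet.of_discrete]
    · simp [hX]

variable {ω} {M : ℕ} {μ : ProbabilityMeasure ℤ}

/-- For fixed `N`, `A N k` says that the walk tries to jump from `x` at time `k` with law `μ`, all
earlier tries since `N` having missed `x + z`; `C N k` says that this try succeeds. The events `C N
k` are disjoint and carry a fixed fraction of the mass of `A N k`, so the latter are summable and
Borel–Cantelli excludes infinitely many tries without success. -/
lemma ae_infinite_visits_add (hω : ∀ x j, M ≤ j → ω x j = μ) (x z : ℤ)
    (hz : (μ : Measure ℤ) {z} ≠ 0) :
    ∀ᵐ X ∂(quenchedLaw ω x₀), {n | X n = x}.Infinite → {n | X n = x + z}.Infinite := by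
  let J : (ℕ → ℤ) → ℕ → Prop := fun X i => X i = x ∧ M ≤ cookieIndex X i
  let A : ℕ → ℕ → Set (ℕ → ℤ) := fun N k =>
    {X | (∀ i, N ≤ i → i < k → J X i → X (i + 1) ≠ x + z) ∧ N ≤ k ∧ J X k}
  let C : ℕ → ℕ → Set (ℕ → ℤ) := fun N k => {X | X ∈ A N k ∧ X (k + 1) - X k ∈ ({z} : Set ℤ)}
  have hJ : ∀ k X Y, (∀ i ≤ k, X i = Y i) → (J X k ↔ J Y k) := fun k X Y h => by
    have := dependsUpTo_cookieIndex k X Y h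
    simp only at this
    simp only [J, h k le_rfl, this]
  have hAd : ∀ N k, DependsUpTo k (· ∈ A N k) := by
    intro N k X Y h
    refine propext (and_congr (forall₃_congr fun i _ hi => ?_)
      (and_congr Iff.rfl (hJ k X Y h)))
    rw [hJ i X Y fun i' hi' => h i' (by omega), h (i + 1) (by omega)]
  have hCm : ∀ N k, MeasurableSet (C N k) := fun N k =>
    (hAd N k).measurableSet.inter (((measurable_pi_apply (k + 1)).sub (measurable_pi_apply k))
      (MeasurableSet.of_discrete (s := ({z} : Set ℤ))))
  have hCd : ∀ N, Pairwise (Function.onFun Disjoint (C N)) := by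
    intro N
    refine (pairwise_disjoint_on _).2 fun i k hik => ?_
    refine Set.disjoint_left.2 fun X hi hk => ?_
    refine hk.1.1 i hi.1.2.1 hik hi.1.2.2 ?_
    have h1 : X (i + 1) - X i = z := hi.2
    have h2 : X i = x := hi.1.2.2.1
    omega
  have hC : ∀ N k, quenchedLaw ω x₀ (C N k) = quenchedLaw ω x₀ (A N k) * (μ : Measure ℤ) {z} := by
    intro N k
    refine (measure_inter_next ω x₀ k (hAd N k) fun _ => {z}).trans ?_
    rw [mul_comm, ← lintegral_indicator_const (hAd N k).measurableSet]
    refine lintegral_congr fun X => ?_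
    by_cases hX : X ∈ A N k
    · simp only [hX, Set.indicator_of_mem, hω _ _ hX.2.2.2]
    · simp [hX]
  have hfin : ∀ N, ∑' k, quenchedLaw ω x₀ (A N k) ≠ ∞ := by
    intro N h
    have h1 : ∑' k, quenchedLaw ω x₀ (C N k) ≤ 1 := by
      rw [← measure_iUnion (hCd N) (hCm N)]
      exact prob_le_one
    simp_rw [hC, ENNReal.tsum_mul_right, h, ENNReal.top_mul hz] at h1
    exact absurd h1 (by simp)
  have hBC : ∀ᵐ X ∂(quenchedLaw ω x₀), ∀ N, ∀ᶠ k in atTop, X ∉ A N k :=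
    ae_all_iff.2 fun N => ae_eventually_notMem (hfin N)
  filter_upwards [hBC] with X hX hinf hfin'
  -- `N` lies beyond the last visit to `x + z`, so every later try from `x` is a failure.
  obtain ⟨N, hN⟩ := eventually_atTop.1 (Nat.cofinite_eq_atTop ▸ hfin'.eventually_cofinite_notMem)
  obtain ⟨k, hk, hk'⟩ := ((Nat.frequently_atTop_iff_infinite.2 hinf).and_eventually
    ((hX N).and ((eventually_le_cookieIndex X x M).and (eventually_ge_atTop N)))).exists
  exact hk'.1 ⟨fun i hi _ _ => hN (i + 1) (by omega), hk'.2.2, hk, hk'.2.1 hk⟩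

end ExcitedWalk

/-! ### Support of `μ` and the pathwise dichotomy in a fixed environment. -/

namespace ExcitedWalk

section Support

variable {μ : ProbabilityMeasure ℤ}

lemma eq_dirac_of_integral_eq_zero {f : ℤ → ℝ} (hf : Integrable f (μ : Measure ℤ))
    (hf0 : ∀ z, f z = 0 → z = 0) (hI : ∫ z, f z ∂(μ : Measure ℤ) = 0)
    (h : ∀ z, (μ : Measure ℤ) {z} ≠ 0 → 0 ≤ f z) : (μ : Measure ℤ) = Measure.dirac 0 := by
  have h1 : 0 ≤ᵐ[(μ : Measure ℤ)] f := ae_iff_of_countable.2 h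
  have h2 := (integral_eq_zero_iff_of_nonneg_ae h1 hf).1 hI
  have h3 : (fun z : ℤ => z) =ᵐ[(μ : Measure ℤ)] fun _ => 0 := h2.mono fun z hz => hf0 z hz
  calc (μ : Measure ℤ) = (μ : Measure ℤ).map fun z => z := Measure.map_id'.symm
    _ = (μ : Measure ℤ).map fun _ => 0 := Measure.map_congr h3
    _ = Measure.dirac 0 := by simp

lemma exists_pos_mem_support (hμ0 : μ ∈ meanZero) (hμδ : (μ : Measure ℤ) ≠ Measure.dirac 0) :
    ∃ z, (μ : Measure ℤ) {z} ≠ 0 ∧ 0 < z := by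
  by_contra! h
  refine hμδ (eq_dirac_of_integral_eq_zero hμ0.1.neg (fun z hz => by simpa using hz) ?_
    fun z hz => by simpa using h z hz)
  have := hμ0.2
  rw [drift] at this
  simp [integral_neg, this]

lemma exists_neg_mem_support (hμ0 : μ ∈ meanZero) (hμδ : (μ : Measure ℤ) ≠ Measure.dirac 0) :
    ∃ z, (μ : Measure ℤ) {z} ≠ 0 ∧ z < 0 := by
  by_contra! h
  exact hμδ (eq_dirac_of_integral_eq_zero hμ0.1 (fun z hz => by simpa using hz) hμ0.2
    fun z hz => by simpa using h z hz)

/-- A set of integers containing elements of both signs generates a group as a monoid. -/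
lemma addSubmonoid_eq_top {S : AddSubmonoid ℤ} {s : Set ℤ} (hs : s ⊆ S)
    (hspan : AddSubgroup.closure s = ⊤) (hp : ∃ z ∈ s, 0 < z) (hn : ∃ z ∈ s, z < 0) : S = ⊤ := by
  obtain ⟨a, ha, ha0⟩ := hp
  obtain ⟨b, hb, hb0⟩ := hn
  have hnsmul : ∀ (n : ℤ), 0 ≤ n → ∀ t ∈ S, n * t ∈ S := by
    intro n hn t ht
    lift n to ℕ using hn
    simpa using S.nsmul_mem ht n
  have key : ∀ g ∈ AddSubgroup.closure s, g ∈ S ∧ -g ∈ S := by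
    intro g hg
    induction hg using AddSubgroup.closure_induction with
    | mem x hx =>
      refine ⟨hs hx, ?_⟩
      rcases lt_trichotomy x 0 with h | rfl | h
      -- The inverse of `x` is a combination with nonnegative coefficients of `x` and an element of
      -- the opposite sign.
      · have : -x = (a - 1) * x + (-x) * a := by ring
        rw [this]
        exact S.add_mem (hnsmul _ (by omega) _ (hs hx)) (hnsmul _ (by omega) _ (hs ha))
      · simp
      · have : -x = (-b - 1) * x + x * b := by ring
        rw [this]
        exact S.add_mem (hnsmul _ (by omega) _ (hs hx)) (hnsmul _ (by omega) _ (hs hb))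
    | zero => simp
    | add x y _ _ hx hy => exact ⟨S.add_mem hx.1 hy.1, by rw [neg_add]; exact S.add_mem hx.2 hy.2⟩
    | neg x _ hx => exact ⟨hx.2, by simpa using hx.1⟩
  exact eq_top_iff.2 fun g _ => (key g (hspan ▸ AddSubgroup.mem_top g)).1

end Support

/-- The paths that are at `y` at time `N` and stay negative afterwards, without a lower bound. -/
def escapesLeft (N : ℕ) (y : ℤ) : Set (ℕ → ℤ) :=
  {X | X N = y ∧ (∀ n ≥ N, X n < 0) ∧ ∀ K : ℕ, ∃ n ≥ N, X n ≤ -(K : ℤ)}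

/-- The paths that are at `y` at time `N` and stay nonnegative afterwards. -/
def staysRight (N : ℕ) (y : ℤ) : Set (ℕ → ℤ) := {X | X N = y ∧ ∀ n ≥ N, 0 ≤ X n}

lemma eventually_notMem_Icc {X : ℕ → ℤ} (h : ∀ x, ¬ {n | X n = x}.Infinite) (L : ℤ) :
    ∀ᶠ n in atTop, X n ∉ Set.Icc (-L) L := by
  have hf : {n | X n ∈ Set.Icc (-L) L}.Finite := by
    have : {n | X n ∈ Set.Icc (-L) L} = ⋃ x ∈ Set.Icc (-L) L, {n | X n = x} := by
      ext n; simp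
    rw [this]
    exact (Set.finite_Icc (-L) L).biUnion fun x _ => Set.not_infinite.1 (h x)
  exact Nat.cofinite_eq_atTop ▸ hf.eventually_cofinite_notMem

/-- A path leaving every bounded set, which makes only finitely many jumps over the origin to the
right by means of cookies and does not escape to the left, tends to `+∞`. -/
lemma tendsto_atTop_of_no_upcrossing {X : ℕ → ℤ} {M : ℕ} {B : ℕ}
    (h : ∀ x, ¬ {n | X n = x}.Infinite)
    (hup : ∀ᶠ k in atTop, ¬ (X k < 0 ∧ 0 ≤ X (k + 1) ∧ cookieIndex X k < M))
    (hB : ∀ k, M ≤ cookieIndex X k → X (k + 1) - X k ∈ Set.Icc (-(B : ℤ)) B)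
    (hleft : ∀ N y, X ∉ escapesLeft N y) : X ∈ transientRight := by
  -- After `n₀` the path avoids `[-B, B]`, so a step of size at most `B` cannot cross the origin; a
  -- negative position is then negative forever.
  obtain ⟨n₀, hn₀⟩ := eventually_atTop.1 (hup.and (eventually_notMem_Icc h B))
  have hstep : ∀ k ≥ n₀, X k < 0 → X (k + 1) < 0 := by
    intro k hk hX
    by_contra! hX'
    obtain ⟨h1, h2⟩ := hn₀ k hk
    by_cases hM : cookieIndex X k < M
    · exact h1 ⟨hX, hX', hM⟩
    · have h3 := hB k (not_lt.1 hM)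
      simp only [Set.mem_Icc] at h2 h3
      omega
  have hpos : ∀ n ≥ n₀, 0 ≤ X n := by
    intro n hn
    by_contra! hX
    have hneg : ∀ m ≥ n, X m < 0 := fun m hm =>
      Nat.le_induction hX (fun k hk => hstep k (hn.le.trans hk)) m hm
    refine hleft n (X n) ⟨rfl, hneg, fun K => ?_⟩
    obtain ⟨m, hm, hm'⟩ := ((eventually_notMem_Icc h K).and (eventually_ge_atTop n)).exists
    refine ⟨m, hm', ?_⟩
    have := hneg m hm'
    simp only [Set.mem_Icc] at hm
    omega
  refine tendsto_atTop.2 fun L => ?_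
  filter_upwards [eventually_notMem_Icc h |L|, eventually_ge_atTop n₀] with n h1 h2
  have := hpos n h2
  have := le_abs_self L
  simp only [Set.mem_Icc] at h1
  omega

variable {ω : CookieEnv} (x₀ : ℤ) {M : ℕ} {μ : ProbabilityMeasure ℤ}

/-- The displacements that carry infinitely visited sites to infinitely visited sites form an
additive submonoid containing the support of `μ`. -/
lemma ae_recurrent_of_infinite (hω : ∀ x j, M ≤ j → ω x j = μ) (hμ0 : μ ∈ meanZero)
    (hμδ : (μ : Measure ℤ) ≠ Measure.dirac 0)
    (hμspan : AddSubgroup.closure {z : ℤ | (μ : Measure ℤ) {z} ≠ 0} = ⊤) :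
    ∀ᵐ X ∂(quenchedLaw ω x₀), ∀ x, {n | X n = x}.Infinite → X ∈ recurrent := by
  have h : ∀ᵐ X ∂(quenchedLaw ω x₀), ∀ x z, (μ : Measure ℤ) {z} ≠ 0 →
      {n | X n = x}.Infinite → {n | X n = x + z}.Infinite := by
    refine ae_all_iff.2 fun x => ae_all_iff.2 fun z => ?_
    by_cases hz : (μ : Measure ℤ) {z} = 0
    · simp [hz]
    · filter_upwards [ae_infinite_visits_add x₀ hω x z hz] with X hX _ using hX
  filter_upwards [h] with X hX x hx y
  let S : AddSubmonoid ℤ :=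
    { carrier := {z | ∀ x, {n | X n = x}.Infinite → {n | X n = x + z}.Infinite}
      zero_mem' := fun x hx => by simpa using hx
      add_mem' := fun {a b} ha hb x hx => by
        rw [← add_assoc]
        exact hb _ (ha _ hx) }
  have hS : S = ⊤ := addSubmonoid_eq_top (fun z hz x => hX x z hz) hμspan
    (exists_pos_mem_support hμ0 hμδ) (exists_neg_mem_support hμ0 hμδ)
  have hy : y - x ∈ S := hS ▸ AddSubmonoid.mem_top _
  simpa using hy x hx

/-- Borel–Cantelli: the expected number of such crossings is at most the displayed sum over cookies,
since each cookie serves at most once. -/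
lemma ae_eventually_no_upcrossing
    (h : ∑' x : ℤ, ∑' j : ℕ, (if x < 0 ∧ j < M then (ω x j : Measure ℤ) (Set.Ici (-x)) else 0) ≠ ∞) :
    ∀ᵐ X ∂(quenchedLaw ω x₀),
      ∀ᶠ k in atTop, ¬ (X k < 0 ∧ 0 ≤ X (k + 1) ∧ cookieIndex X k < M) := by
  let A : ℕ → Set (ℕ → ℤ) := fun k => {X | X k < 0 ∧ cookieIndex X k < M}
  have hA : ∀ k, DependsUpTo k (· ∈ A k) := fun k X Y h => by
    have := dependsUpTo_cookieIndex k X Y h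
    simp only at this
    simp [A, h k le_rfl, this]
  have hle : ∑' k, quenchedLaw ω x₀ {X | X ∈ A k ∧ X (k + 1) - X k ∈ Set.Ici (-X k)} ≠ ∞ := by
    simp_rw [fun k => measure_inter_next ω x₀ k (hA k) fun x => Set.Ici (-x)]
    refine ne_top_of_le_ne_top h ?_
    set c : ℤ → ℕ → ℝ≥0∞ := fun x j =>
      if x < 0 ∧ j < M then (ω x j : Measure ℤ) (Set.Ici (-x)) else 0
    have hc : ∀ k X, (A k).indicator (fun X => (ω (X k) (cookieIndex X k) : Measure ℤ)
        (Set.Ici (-X k))) X = c (X k) (cookieIndex X k) := fun k X => by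
      simp [c, A, Set.indicator]
    simp_rw [hc]
    have hm : ∀ k, Measurable fun X : ℕ → ℤ => c (X k) (cookieIndex X k) := fun k =>
      DependsUpTo.measurable (n := k) fun X Y h => by
        have := dependsUpTo_cookieIndex k X Y h
        simp only at this
        simp only [h k le_rfl, this]
    rw [← lintegral_tsum fun k => (hm k).aemeasurable]
    refine (lintegral_mono fun X => tsum_cookie_le X c).trans ?_
    simp [c]
  filter_upwards [ae_eventually_notMem hle] with X hX
  filter_upwards [hX] with k hk hk'
  refine hk ⟨⟨hk'.1, hk'.2.2⟩, ?_⟩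
  simp only [Set.mem_Ici]
  omega

lemma ae_step_mem_of_le_cookieIndex (hω : ∀ x j, M ≤ j → ω x j = μ) {s : Set ℤ}
    (hs : (μ : Measure ℤ) s = 1) :
    ∀ᵐ X ∂(quenchedLaw ω x₀), ∀ k, M ≤ cookieIndex X k → X (k + 1) - X k ∈ s := by
  refine ae_all_iff.2 fun k => ?_
  have hA : DependsUpTo k (· ∈ {X : ℕ → ℤ | M ≤ cookieIndex X k}) := fun X Y h => by
    have := dependsUpTo_cookieIndex k X Y h
    simp only at this
    simp [this]
  have h0 := measure_inter_next ω x₀ k hA fun _ => sᶜ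
  have hs' : (μ : Measure ℤ) sᶜ = 0 := (prob_compl_eq_zero_iff MeasurableSet.of_discrete).2 hs
  have h1 : ∀ X : ℕ → ℤ, ({X : ℕ → ℤ | M ≤ cookieIndex X k}).indicator
      (fun X => (ω (X k) (cookieIndex X k) : Measure ℤ) sᶜ) X = 0 := by
    intro X
    by_cases hX : M ≤ cookieIndex X k
    · simp [hω _ _ hX, hs']
    · simp [hX]
  simp only [h1, lintegral_zero] at h0
  refine ae_iff.2 (Eq.trans ?_ h0)
  congr 1
  ext X
  simp

theorem quenched_ae_recurrent_or_transientRight (hω : ∀ x j, M ≤ j → ω x j = μ)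
    (hμ0 : μ ∈ meanZero) (hμδ : (μ : Measure ℤ) ≠ Measure.dirac 0)
    (hμB : ∃ B : ℕ, (μ : Measure ℤ) (Set.Icc (-(B : ℤ)) (B : ℤ)) = 1)
    (hμspan : AddSubgroup.closure {z : ℤ | (μ : Measure ℤ) {z} ≠ 0} = ⊤)
    (hup : ∑' x : ℤ, ∑' j : ℕ,
      (if x < 0 ∧ j < M then (ω x j : Measure ℤ) (Set.Ici (-x)) else 0) ≠ ∞)
    (hleft : ∀ N y, quenchedLaw ω x₀ (escapesLeft N y) = 0) :
    ∀ᵐ X ∂(quenchedLaw ω x₀), X ∈ recurrent ∪ transientRight := by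
  obtain ⟨B, hB⟩ := hμB
  have hleft' : ∀ᵐ X ∂(quenchedLaw ω x₀), ∀ N y, X ∉ escapesLeft N y :=
    ae_all_iff.2 fun N => ae_all_iff.2 fun y => measure_eq_zero_iff_ae_notMem.1 (hleft N y)
  filter_upwards [ae_recurrent_of_infinite x₀ hω hμ0 hμδ hμspan, ae_eventually_no_upcrossing x₀ hup,
    ae_step_mem_of_le_cookieIndex x₀ hω hB, hleft'] with X h1 h2 h3 h4
  by_cases h : ∃ x, {n | X n = x}.Infinite
  · exact Or.inl (h1 _ h.choose_spec)
  · exact Or.inr (tendsto_atTop_of_no_upcrossing (not_exists.1 h) h2 h3 h4)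

end ExcitedWalk

/-! ### Truncation, the mean ergodic theorem and Cesàro comparisons. -/

lemma tendsto_lintegral_tsub_natCast {Ω : Type*} [MeasurableSpace Ω] {m : Measure Ω}
    {f : Ω → ℝ≥0∞} (hf : Measurable f) (hf' : ∫⁻ ω, f ω ∂m ≠ ∞) :
    Tendsto (fun k : ℕ => ∫⁻ ω, (f ω - k) ∂m) atTop (nhds 0) := by
  have h := tendsto_lintegral_of_dominated_convergence (μ := m) (F := fun (k : ℕ) ω => f ω - k)
    (f := fun _ => 0) f (fun k => hf.sub_const _) (fun k => ae_of_all _ fun ω => tsub_le_self) hf' ?_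
  · simpa using h
  · filter_upwards [ae_lt_top hf hf'] with ω hω
    refine tendsto_const_nhds.congr' ?_
    obtain ⟨n, hn⟩ := ENNReal.exists_nat_gt hω.ne
    filter_upwards [eventually_ge_atTop n] with k hk
    exact (tsub_eq_zero_of_le (hn.le.trans (by exact_mod_cast hk))).symm

section MeanErgodic

variable {Ω : Type*} [MeasurableSpace Ω] {η : Measure Ω} [IsProbabilityMeasure η] {T : Ω → Ω}

/-- The mean ergodic theorem, tested against a square-integrable function. -/
lemma Ergodic.tendsto_inner_birkhoffAverage (hT : Ergodic T η) (f g : Lp ℝ 2 η) :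
    Tendsto (fun K : ℕ => (K : ℝ)⁻¹ * ∑ n ∈ Finset.range K, ∫ ω, f (T^[n] ω) * g ω ∂η) atTop
      (nhds ((∫ ω, f ω ∂η) * ∫ ω, g ω ∂η)) := by
  let U : Lp ℝ 2 η →ₗᵢ[ℝ] Lp ℝ 2 η := Lp.compMeasurePreservingₗᵢ ℝ T hT.toMeasurePreserving
  let V : Lp ℝ 2 η →L[ℝ] Lp ℝ 2 η := U.toContinuousLinearMap
  have hV : ∀ n (φ : Lp ℝ 2 η), V^[n] φ =ᵐ[η] φ ∘ T^[n] := by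
    intro n φ
    have h1 : V^[n] φ = Lp.compMeasurePreserving T^[n] (hT.toMeasurePreserving.iterate n) φ := by
      rw [← Lp.compMeasurePreserving_iterate]
      rfl
    rw [h1]
    exact Lp.coeFn_compMeasurePreserving φ _
  -- Von Neumann's theorem for the Koopman isometry. The limit is invariant, hence constant by
  -- ergodicity; testing against `1` identifies the constant as the mean of `f`.
  obtain ⟨p, hp⟩ : ∃ p : (V.eqLocus (1 : Lp ℝ 2 η →L[ℝ] Lp ℝ 2 η)),
      Tendsto (birkhoffAverage ℝ V id · f) atTop (nhds (p : Lp ℝ 2 η)) :=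
    ⟨_, V.tendsto_birkhoffAverage_orthogonalProjection U.norm_toContinuousLinearMap_le f⟩
  have hpV : V p = p := p.2
  obtain ⟨c, hc⟩ : ∃ c, (p : Lp ℝ 2 η) =ᵐ[η] Function.const _ c := by
    refine hT.ae_eq_const_of_ae_eq_comp_ae (Lp.aestronglyMeasurable _) ?_
    have := hV 1 p
    simp only [Function.iterate_one, hpV] at this
    exact this.symm
  have hlim : ∀ φ : Lp ℝ 2 η, Tendsto (fun K : ℕ => (K : ℝ)⁻¹ *
      ∑ n ∈ Finset.range K, ∫ ω, f (T^[n] ω) * φ ω ∂η) atTop (nhds (c * ∫ ω, φ ω ∂η)) := by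
    intro φ
    have h0 : Continuous fun ψ : Lp ℝ 2 η => inner ℝ ψ φ := continuous_id.inner continuous_const
    have h1 := (h0.tendsto (p : Lp ℝ 2 η)).comp hp
    refine (h1.congr fun K => ?_).trans (le_of_eq ?_)
    · simp only [Function.comp, id, birkhoffAverage, birkhoffSum, real_inner_smul_left, sum_inner]
      congr 1
      refine Finset.sum_congr rfl fun n _ => ?_
      rw [L2.inner_def]
      refine integral_congr_ae ?_
      filter_upwards [hV n f] with ω h
      simp [h, mul_comm]
    · congr 1
      rw [L2.inner_def, ← integral_const_mul]
      refine integral_congr_ae ?_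
      filter_upwards [hc] with ω h
      simp [h, mul_comm]
  have hc' : c = ∫ ω, f ω ∂η := by
    let one : Lp ℝ 2 η := (memLp_const (1 : ℝ)).toLp
    have hone : one =ᵐ[η] fun _ => 1 := MemLp.coeFn_toLp _
    have hi : ∫ ω, one ω ∂η = 1 := by rw [integral_congr_ae hone]; simp
    have h1 := hlim one
    rw [hi, mul_one] at h1
    refine tendsto_nhds_unique h1 (Tendsto.congr' ?_ tendsto_const_nhds)
    filter_upwards [eventually_gt_atTop 0] with K hK
    have h2 : ∀ n, ∫ ω, f (T^[n] ω) * one ω ∂η = ∫ ω, f ω ∂η := by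
      intro n
      have hn := hT.toMeasurePreserving.iterate n
      rw [show ∫ ω, f ω ∂η = ∫ ω, f ω ∂(η.map T^[n]) by rw [hn.map_eq],
        integral_map hn.measurable.aemeasurable (by
          rw [hn.map_eq]; exact Lp.aestronglyMeasurable f)]
      refine integral_congr_ae ?_
      filter_upwards [hone] with ω h
      simp [h]
    have : (K : ℝ) ≠ 0 := by positivity
    simp [h2]
    field_simp
  exact hc' ▸ hlim g

/-- Upper bound for Cesàro averages of correlations with a function bounded by `1`. -/
lemma Ergodic.eventually_sum_lintegral_mul_le (hT : Ergodic T η) {f g : Ω → ℝ≥0∞}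
    (hf : Measurable f) (hf' : ∫⁻ ω, f ω ∂η ≠ ∞) (hg : Measurable g) (hg1 : ∀ ω, g ω ≤ 1)
    {ε : ℝ≥0∞} (hε : ε ≠ 0) :
    ∀ᶠ K : ℕ in atTop, ∑ n ∈ Finset.range K, ∫⁻ ω, f (T^[n] ω) * g ω ∂η
      ≤ K * ((∫⁻ ω, f ω ∂η) * (∫⁻ ω, g ω ∂η) + ε) := by
  have hε2 : 0 < ε / 2 := ENNReal.half_pos hε
  -- Only integrability of `f` is given, so it is truncated at `C` to enter `L²`. The tail costs at
  -- most `ε / 2` for every iterate, by invariance, and `r` bounds the ergodic error of the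
  -- truncated part.
  obtain ⟨C, hC⟩ := ((tendsto_lintegral_tsub_natCast hf hf').eventually_lt_const hε2).exists
  obtain ⟨r, hr0, hr⟩ := ENNReal.lt_iff_exists_nnreal_btwn.1 hε2
  have hr0' : (0 : ℝ) < r := by exact_mod_cast hr0
  let F : Ω → ℝ := fun ω => (min (f ω) C).toReal
  let G : Ω → ℝ := fun ω => (g ω).toReal
  have hFt : ∀ ω, min (f ω) C ≠ ∞ := fun ω => ne_top_of_le_ne_top (by simp) (min_le_right _ _)
  have hgt : ∀ ω, g ω ≠ ∞ := fun ω => ne_top_of_le_ne_top (by simp) (hg1 ω)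
  have hFm : Measurable F := (hf.min measurable_const).ennreal_toReal
  have hGm : Measurable G := hg.ennreal_toReal
  have hF0 : ∀ ω, 0 ≤ F ω := fun ω => ENNReal.toReal_nonneg
  have hG0 : ∀ ω, 0 ≤ G ω := fun ω => ENNReal.toReal_nonneg
  have hFC : ∀ ω, ‖F ω‖ ≤ C := fun ω => by
    rw [Real.norm_of_nonneg (hF0 ω)]
    exact ENNReal.toReal_le_of_le_ofReal (by positivity) (by simp)
  have hG1 : ∀ ω, ‖G ω‖ ≤ 1 := fun ω => by
    rw [Real.norm_of_nonneg (hG0 ω)]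
    exact ENNReal.toReal_le_of_le_ofReal (by positivity) (by simpa using hg1 ω)
  have hF2 : MemLp F 2 η := .of_bound hFm.aestronglyMeasurable C (ae_of_all _ hFC)
  have hG2 : MemLp G 2 η := .of_bound hGm.aestronglyMeasurable 1 (ae_of_all _ hG1)
  have hlim := hT.tendsto_inner_birkhoffAverage hF2.toLp hG2.toLp
  rw [integral_congr_ae hF2.coeFn_toLp, integral_congr_ae hG2.coeFn_toLp] at hlim
  have hterm : ∀ n, ∫⁻ ω, min (f (T^[n] ω)) C * g ω ∂η
      = ENNReal.ofReal (∫ ω, hF2.toLp F (T^[n] ω) * hG2.toLp G ω ∂η) := by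
    intro n
    have hn := hT.toMeasurePreserving.iterate n
    have h1 : ∫ ω, hF2.toLp F (T^[n] ω) * hG2.toLp G ω ∂η = ∫ ω, F (T^[n] ω) * G ω ∂η := by
      refine integral_congr_ae ?_
      filter_upwards [hn.quasiMeasurePreserving.ae_eq_comp hF2.coeFn_toLp, hG2.coeFn_toLp]
        with ω h h'
      simp only [Function.comp] at h
      rw [h, h']
    rw [h1, ofReal_integral_eq_lintegral_ofReal]
    · refine lintegral_congr fun ω => ?_
      rw [ENNReal.ofReal_mul (hF0 _), ENNReal.ofReal_toReal (hFt _), ENNReal.ofReal_toReal (hgt _)]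
    · refine Integrable.of_bound ((hFm.comp hn.measurable).mul hGm).aestronglyMeasurable (C * 1)
        (ae_of_all _ fun ω => ?_)
      rw [norm_mul]
      exact mul_le_mul (hFC _) (hG1 _) (norm_nonneg _) (by positivity)
    · exact ae_of_all _ fun ω => mul_nonneg (hF0 _) (hG0 _)
  have hFi : ENNReal.ofReal (∫ ω, F ω ∂η) ≤ ∫⁻ ω, f ω ∂η := by
    rw [ofReal_integral_eq_lintegral_ofReal (hF2.integrable (by norm_num)) (ae_of_all _ hF0)]
    refine lintegral_mono fun ω => ?_
    rw [ENNReal.ofReal_toReal (hFt _)]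
    exact min_le_left _ _
  have hGi : ENNReal.ofReal (∫ ω, G ω ∂η) = ∫⁻ ω, g ω ∂η := by
    rw [ofReal_integral_eq_lintegral_ofReal (hG2.integrable (by norm_num)) (ae_of_all _ hG0)]
    exact lintegral_congr fun ω => ENNReal.ofReal_toReal (hgt _)
  have hFI0 : 0 ≤ ∫ ω, F ω ∂η := integral_nonneg hF0
  have hGI0 : 0 ≤ ∫ ω, G ω ∂η := integral_nonneg hG0
  filter_upwards [hlim.eventually_lt_const (lt_add_of_pos_right _ hr0'), eventually_gt_atTop 0]
    with K hK hK0
  have hmin : ∑ n ∈ Finset.range K, ∫⁻ ω, min (f (T^[n] ω)) C * g ω ∂η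
      ≤ K * ((∫⁻ ω, f ω ∂η) * (∫⁻ ω, g ω ∂η) + ε / 2) := by
    have hK0' : (0 : ℝ) < K := by exact_mod_cast hK0
    rw [inv_mul_lt_iff₀ hK0'] at hK
    simp_rw [hterm]
    rw [← ENNReal.ofReal_sum_of_nonneg fun n _ => ?_]
    · refine (ENNReal.ofReal_le_ofReal hK.le).trans ?_
      rw [ENNReal.ofReal_mul hK0'.le, ENNReal.ofReal_add (by positivity) hr0'.le,
        ENNReal.ofReal_mul hFI0, hGi]
      simp only [ENNReal.ofReal_natCast, ENNReal.ofReal_coe_nnreal]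
      gcongr
    · refine integral_nonneg_of_ae ?_
      have hn := hT.toMeasurePreserving.iterate n
      filter_upwards [hn.quasiMeasurePreserving.ae_eq_comp hF2.coeFn_toLp, hG2.coeFn_toLp]
        with ω h h'
      simp only [Function.comp] at h
      rw [h, h']
      exact mul_nonneg (hF0 _) (hG0 _)
  have htail : ∀ n, ∫⁻ ω, (f (T^[n] ω) - C) ∂η ≤ ε / 2 := fun n => by
    rw [(hT.toMeasurePreserving.iterate n).lintegral_comp (f := fun ω => f ω - C)
      (hf.sub_const _)]
    exact hC.le
  have hsplit : ∀ n, ∫⁻ ω, f (T^[n] ω) * g ω ∂η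
      ≤ ∫⁻ ω, min (f (T^[n] ω)) C * g ω ∂η + ε / 2 := fun n => by
    refine le_trans ?_ (add_le_add_right (htail n) _)
    have hm : Measurable fun ω => f (T^[n] ω) - C :=
      (hf.comp (hT.toMeasurePreserving.iterate n).measurable).sub_const _
    rw [← lintegral_add_right _ hm]
    refine lintegral_mono fun ω => ?_
    calc f (T^[n] ω) * g ω = (min (f (T^[n] ω)) C + (f (T^[n] ω) - C)) * g ω := by
          rcases le_total (f (T^[n] ω)) C with h | h
          · rw [min_eq_left h, tsub_eq_zero_of_le h, add_zero]
          · simp [h, add_tsub_cancel_of_le]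
      _ ≤ _ := by
          rw [add_mul]
          gcongr
          exact mul_le_of_le_one_right zero_le (hg1 ω)
  calc _ ≤ ∑ n ∈ Finset.range K, (∫⁻ ω, min (f (T^[n] ω)) C * g ω ∂η + ε / 2) :=
        Finset.sum_le_sum fun n _ => hsplit n
    _ ≤ K * ((∫⁻ ω, f ω ∂η) * (∫⁻ ω, g ω ∂η) + ε / 2) + K * (ε / 2) := by
        rw [Finset.sum_add_distrib]
        simpa using add_le_add_left hmin _
    _ = _ := by rw [← mul_add, add_assoc, ENNReal.add_halves]

end MeanErgodic

/-- Division by `K` makes the fixed cost `c` disappear; this is how bounds for exits at distance `K`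
become bounds for limiting events. -/
lemma le_of_eventually_natCast_mul_le {p q c : ℝ≥0∞} (hc : c ≠ ∞)
    (h : ∀ᶠ K : ℕ in atTop, K * p ≤ c + K * q) : p ≤ q := by
  have h1 : Tendsto (fun K : ℕ => c / K + q) atTop (nhds (0 + q)) :=
    (ENNReal.Tendsto.const_div ENNReal.tendsto_nat_nhds_top (Or.inr hc)).add_const q |>.congr
      (fun _ => rfl) |>.trans (by simp)
  rw [zero_add] at h1
  refine ge_of_tendsto h1 ?_
  filter_upwards [h, eventually_gt_atTop 0] with K hK hK0
  have hK0' : (K : ℝ≥0∞) ≠ 0 := by exact_mod_cast hK0.ne'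
  have hKt : (K : ℝ≥0∞) ≠ ∞ := by simp
  calc p = (K * p) / K := by rw [mul_comm, ENNReal.mul_div_cancel_right hK0' hKt]
    _ ≤ (c + K * q) / K := ENNReal.div_le_div_right hK _
    _ = c / K + q := by
      rw [ENNReal.add_div, mul_comm, ENNReal.mul_div_cancel_right hK0' hKt]

lemma exists_sum_range_le_of_tendsto_zero {a : ℕ → ℝ≥0∞} (ha : ∀ k, a k ≠ ∞)
    (h : Tendsto a atTop (nhds 0)) {ε : ℝ≥0∞} (hε : ε ≠ 0) :
    ∃ c : ℝ≥0∞, c ≠ ∞ ∧ ∀ K : ℕ, ∑ k ∈ Finset.range K, a k ≤ c + K * ε := by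
  obtain ⟨n, hn⟩ := eventually_atTop.1 (h.eventually_lt_const (pos_iff_ne_zero.2 hε))
  refine ⟨∑ k ∈ Finset.range n, a k, ENNReal.sum_ne_top.2 fun k _ => ha k, fun K => ?_⟩
  induction K with
  | zero => simp
  | succ K ih =>
    by_cases hK : K + 1 ≤ n
    · exact (Finset.sum_le_sum_of_subset (Finset.range_mono hK)).trans le_self_add
    · rw [Finset.sum_range_succ]
      push_cast
      rw [add_mul, one_mul, ← add_assoc]
      exact add_le_add ih (hn K (by omega)).le

/-- All `f ∘ T^[k]` have the same law, so they are uniformly integrable and a bounded factor tending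
to `0` in mean wins. -/
lemma tendsto_lintegral_comp_iterate_mul {Ω : Type*} [MeasurableSpace Ω] {η : Measure Ω}
    {T : Ω → Ω} (hT : MeasurePreserving T η η) {f : Ω → ℝ≥0∞} (hf : Measurable f)
    (hf' : ∫⁻ ω, f ω ∂η ≠ ∞) {q : ℕ → Ω → ℝ≥0∞} (hq : ∀ k, Measurable (q k))
    (hq1 : ∀ k ω, q k ω ≤ 1) (hq0 : Tendsto (fun k => ∫⁻ ω, q k ω ∂η) atTop (nhds 0)) :
    Tendsto (fun k => ∫⁻ ω, f (T^[k] ω) * q k ω ∂η) atTop (nhds 0) := by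
  refine ENNReal.tendsto_nhds_zero.2 fun ε hε => ?_
  have hε2 : 0 < ε / 2 := ENNReal.half_pos hε.ne'
  obtain ⟨C, hC⟩ := ((tendsto_lintegral_tsub_natCast hf hf').eventually_lt_const hε2).exists
  have h1 : Tendsto (fun k => (C : ℝ≥0∞) * ∫⁻ ω, q k ω ∂η) atTop (nhds 0) := by
    simpa using ENNReal.Tendsto.const_mul hq0 (Or.inr (by simp : (C : ℝ≥0∞) ≠ ∞))
  filter_upwards [h1.eventually_lt_const hε2] with k hk
  have hTk := hT.iterate k
  have hm : Measurable fun ω => f (T^[k] ω) - C := (hf.comp hTk.measurable).sub_const _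
  calc ∫⁻ ω, f (T^[k] ω) * q k ω ∂η
      ≤ ∫⁻ ω, (C * q k ω + (f (T^[k] ω) - C)) ∂η := by
        refine lintegral_mono fun ω => ?_
        calc f (T^[k] ω) * q k ω ≤ (C + (f (T^[k] ω) - C)) * q k ω := by
              gcongr
              exact le_add_tsub
          _ ≤ _ := by
              rw [add_mul]
              gcongr
              exact mul_le_of_le_one_right zero_le (hq1 k ω)
    _ = C * ∫⁻ ω, q k ω ∂η + ∫⁻ ω, (f (T^[k] ω) - C) ∂η := by
        rw [lintegral_add_right _ hm, lintegral_const_mul _ (hq k)]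
    _ ≤ ε / 2 + ε / 2 := by
        refine add_le_add hk.le ?_
        rw [hTk.lintegral_comp (f := fun ω => f ω - C) (hf.sub_const _)]
        exact hC.le
    _ = ε := ENNReal.add_halves ε

/-- The mean of the positive part is the mean plus that of the negative part. For the Lyapunov
functions below, the negative part is the overshoot. -/
lemma lintegral_ofReal_le_add {α : Type*} [MeasurableSpace α] {ν : Measure α} {f : α → ℝ}
    (hf : Integrable f ν) :
    ∫⁻ z, ENNReal.ofReal (f z) ∂ν
      ≤ ENNReal.ofReal (∫ z, f z ∂ν) + ∫⁻ z, ENNReal.ofReal (-f z) ∂ν := by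
  have h1 := hf.lintegral_lt_top
  have h2 := hf.neg.lintegral_lt_top
  have h3 := integral_eq_lintegral_pos_part_sub_lintegral_neg_part hf
  simp only [Pi.neg_apply] at h2
  rw [← ENNReal.ofReal_toReal h1.ne, ← ENNReal.ofReal_toReal h2.ne]
  refine le_trans (ENNReal.ofReal_le_ofReal ?_) ENNReal.ofReal_add_le
  rw [h3]
  simp

/-! ### Quenched exit bounds to the left and to the right. -/

namespace ExcitedWalk

/-- The expected amount by which a step of law `ν` exceeds the length `k`. -/
noncomputable def excess (ν : ProbabilityMeasure ℤ) (k : ℕ) : ℝ≥0∞ :=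
  ∫⁻ z : ℤ, (ENNReal.ofReal |(z : ℝ)| - k) ∂(ν : Measure ℤ)

lemma ofReal_sub_natAbs_le {a x z : ℤ} (h : a + |x| ≤ |z|) :
    ENNReal.ofReal (a : ℝ) ≤ ENNReal.ofReal |(z : ℝ)| - (x.natAbs : ℕ) := by
  rw [← ENNReal.ofReal_natCast, ← ENNReal.ofReal_sub _ (by positivity)]
  refine ENNReal.ofReal_le_ofReal ?_
  rw [Nat.cast_natAbs, le_sub_iff_add_le]
  exact_mod_cast h

section Drift

variable {ν : ProbabilityMeasure ℤ}

lemma lintegral_ofReal_add_le (hν : HasFiniteMean ν) (a : ℤ) :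
    ∫⁻ z : ℤ, ENNReal.ofReal ((a + z : ℤ) : ℝ) ∂(ν : Measure ℤ) ≤
      ENNReal.ofReal (a + drift ν) + ∫⁻ z : ℤ, ENNReal.ofReal ((-(a + z) : ℤ) : ℝ) ∂(ν : Measure ℤ) := by
  have h := lintegral_ofReal_le_add (f := fun z : ℤ => ((a : ℝ) + z)) ((integrable_const _).add hν)
  rw [integral_add (integrable_const _) hν] at h
  simpa [drift] using h

lemma lintegral_ofReal_sub_le (hν : HasFiniteMean ν) (a : ℤ) :
    ∫⁻ z : ℤ, ENNReal.ofReal ((a - z : ℤ) : ℝ) ∂(ν : Measure ℤ) ≤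
      ENNReal.ofReal (a - drift ν) + ∫⁻ z : ℤ, ENNReal.ofReal ((z - a : ℤ) : ℝ) ∂(ν : Measure ℤ) := by
  have h := lintegral_ofReal_le_add (f := fun z : ℤ => ((a : ℝ) - z)) ((integrable_const _).sub hν)
  rw [integral_sub (integrable_const _) hν] at h
  simpa [drift] using h

variable {B : ℕ}

lemma ae_mem_Icc (hB : (ν : Measure ℤ) (Set.Icc (-(B : ℤ)) (B : ℤ)) = 1) :
    ∀ᵐ z ∂(ν : Measure ℤ), z ∈ Set.Icc (-(B : ℤ)) (B : ℤ) :=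
  (prob_compl_eq_zero_iff MeasurableSet.of_discrete).2 hB

end Drift

variable {ω : CookieEnv} (x₀ : ℤ) {M : ℕ} {μ : ProbabilityMeasure ℤ} {B : ℕ}

/-- Quenched bound for the probability to move far to the left while staying negative. -/
lemma mul_measure_exits_left_le (hω : ω ∈ positiveEnv M μ) (hμ0 : μ ∈ meanZero)
    (hB : (μ : Measure ℤ) (Set.Icc (-(B : ℤ)) (B : ℤ)) = 1) (N : ℕ) (y : ℤ) (K : ℕ) :
    K * quenchedLaw ω x₀ (exits (Set.Ioo (-(K : ℤ)) 0) (Set.Iic (-(K : ℤ))) N y)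
      ≤ ENNReal.ofReal ((B - y : ℤ) : ℝ) +
        ∑ k ∈ Finset.range K, ∑ j ∈ Finset.range M, excess (ω (-(k : ℤ)) j) k := by
  -- The offset `B` in `u` keeps `B - (x + z)` nonnegative for `x < 0` and every step of law `μ`.
  -- Such steps therefore cost nothing, and only the first `M` cookies are charged.
  let c : ℤ → ℕ → ℝ≥0∞ := fun x j => if j < M then excess (ω x j) x.natAbs else 0
  have hu : ∀ x ∈ Set.Ioo (-(K : ℤ)) 0, ∀ j,
      ∫⁻ z, ENNReal.ofReal ((B - (x + z) : ℤ) : ℝ) ∂(ω x j : Measure ℤ)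
        ≤ ENNReal.ofReal ((B - x : ℤ) : ℝ) + c x j := by
    intro x hx j
    have h1 : ∀ z : ℤ, (B - (x + z) : ℤ) = (B - x) - z := fun z => by ring
    simp_rw [h1]
    by_cases hj : j < M
    · obtain ⟨hm, hd⟩ := (hω x).1 j hj
      refine (lintegral_ofReal_sub_le hm _).trans (add_le_add ?_ ?_)
      · exact ENNReal.ofReal_le_ofReal (by linarith)
      · simp only [c, hj, if_true, excess]
        refine lintegral_mono fun z => ofReal_sub_natAbs_le ?_
        have := le_abs_self z
        rw [abs_of_neg hx.2]
        omega
    · rw [(hω x).2 j (not_lt.1 hj)]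
      refine (lintegral_ofReal_sub_le hμ0.1 _).trans (add_le_add ?_ ?_)
      · rw [hμ0.2, sub_zero]
      · refine le_of_eq_of_le ?_ zero_le
        refine (lintegral_congr_ae ?_).trans lintegral_zero
        filter_upwards [ae_mem_Icc hB] with z hz
        refine ENNReal.ofReal_of_nonpos ?_
        have h1 := hz.2
        have h2 := hx.2
        exact_mod_cast (by omega : z - (B - x) ≤ 0)
  refine (mul_measure_exits_le ω x₀ N y (u := fun x => ENNReal.ofReal ((B - x : ℤ) : ℝ)) hu
    (Set.disjoint_left.2 fun x h1 h2 => not_lt.2 h1 h2.1) (a := K) fun x hx => ?_).trans ?_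
  · rw [← ENNReal.ofReal_natCast]
    refine ENNReal.ofReal_le_ofReal ?_
    have : (K : ℤ) ≤ B - x := by
      have : x ≤ -(K : ℤ) := hx
      omega
    exact_mod_cast this
  · gcongr
    obtain ⟨e, he⟩ : ∃ e : ℕ ↪ ℤ, ∀ k, e k = -(k : ℤ) :=
      ⟨⟨fun k => -(k : ℤ), fun a b h => by simpa using h⟩, fun _ => rfl⟩
    have hzero : ∀ x ∉ (Finset.range K).map e,
        quenchedLaw ω x₀ (visits (Set.Ioo (-(K : ℤ)) 0) N y x) * ∑' j, c x j = 0 := by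
      intro x hx
      have : visits (Set.Ioo (-(K : ℤ)) 0) N y x = ∅ := by
        refine Set.eq_empty_of_forall_notMem fun X => ?_
        rintro ⟨k, hk, rfl⟩
        have h1 := hk.2 k le_rfl
        refine hx (Finset.mem_map.2 ⟨(X (N + k)).natAbs, ?_, ?_⟩)
        · simp only [Set.mem_Ioo] at h1
          simp only [Finset.mem_range]
          omega
        · simp only [Set.mem_Ioo] at h1
          rw [he]
          omega
      simp [this]
    rw [tsum_eq_sum hzero, Finset.sum_map]
    refine Finset.sum_le_sum fun k _ => ?_
    refine (mul_le_of_le_one_left zero_le prob_le_one).trans (le_of_eq ?_)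
    rw [tsum_eq_sum (s := Finset.range M) fun j hj => by simp [c, Finset.mem_range.not.1 hj]]
    refine Finset.sum_congr rfl fun j hj => ?_
    simp [c, he, Finset.mem_range.1 hj]

/-- Quenched bound for the probability to move far to the right while staying nonnegative. -/
lemma mul_measure_exits_right_le (hω : ω ∈ positiveEnv M μ) (hμ0 : μ ∈ meanZero)
    (hB : (μ : Measure ℤ) (Set.Icc (-(B : ℤ)) (B : ℤ)) = 1) (N : ℕ) (y : ℤ) (K : ℕ) :
    K * quenchedLaw ω x₀ (exits (Set.Ico 0 (K : ℤ)) (Set.Ici (K : ℤ)) N y)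
      ≤ ENNReal.ofReal ((y + B : ℤ) : ℝ) + ∑ k ∈ Finset.range K,
        (quenchedLaw ω x₀ (visits (Set.Ici 0) N y k) *
            ∑ j ∈ Finset.range M, ENNReal.ofReal (drift (ω k j)) +
          ∑ j ∈ Finset.range M, excess (ω k j) k) := by
  let c : ℤ → ℕ → ℝ≥0∞ := fun x j =>
    if j < M then ENNReal.ofReal (drift (ω x j)) + excess (ω x j) x.natAbs else 0
  have hu : ∀ x ∈ Set.Ico 0 (K : ℤ), ∀ j,
      ∫⁻ z, ENNReal.ofReal ((x + z + B : ℤ) : ℝ) ∂(ω x j : Measure ℤ)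
        ≤ ENNReal.ofReal ((x + B : ℤ) : ℝ) + c x j := by
    intro x hx j
    have h1 : ∀ z : ℤ, (x + z + B : ℤ) = (x + B) + z := fun z => by ring
    simp_rw [h1]
    by_cases hj : j < M
    · obtain ⟨hm, hd⟩ := (hω x).1 j hj
      simp only [c, hj, if_true, ← add_assoc]
      refine (lintegral_ofReal_add_le hm _).trans (add_le_add ENNReal.ofReal_add_le ?_)
      refine lintegral_mono fun z => ofReal_sub_natAbs_le ?_
      have := neg_le_abs z
      rw [abs_of_nonneg hx.1]
      omega
    · rw [(hω x).2 j (not_lt.1 hj)]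
      refine (lintegral_ofReal_add_le hμ0.1 _).trans (add_le_add ?_ ?_)
      · rw [hμ0.2, add_zero]
      · refine le_of_eq_of_le ?_ zero_le
        refine (lintegral_congr_ae ?_).trans lintegral_zero
        filter_upwards [ae_mem_Icc hB] with z hz
        refine ENNReal.ofReal_of_nonpos ?_
        have h1 := hz.1
        have h2 := hx.1
        exact_mod_cast (by omega : -(x + B + z) ≤ 0)
  refine (mul_measure_exits_le ω x₀ N y (u := fun x => ENNReal.ofReal ((x + B : ℤ) : ℝ)) hu
    (Set.disjoint_left.2 fun x h1 h2 => not_lt.2 h1 h2.2) (a := K) fun x hx => ?_).trans ?_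
  · rw [← ENNReal.ofReal_natCast]
    refine ENNReal.ofReal_le_ofReal ?_
    have : (K : ℤ) ≤ x + B := by
      have : (K : ℤ) ≤ x := hx
      omega
    exact_mod_cast this
  · gcongr
    obtain ⟨e, he⟩ : ∃ e : ℕ ↪ ℤ, ∀ k, e k = (k : ℤ) :=
      ⟨⟨fun k => (k : ℤ), fun a b h => by simpa using h⟩, fun _ => rfl⟩
    have hzero : ∀ x ∉ (Finset.range K).map e,
        quenchedLaw ω x₀ (visits (Set.Ico 0 (K : ℤ)) N y x) * ∑' j, c x j = 0 := by
      intro x hx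
      have : visits (Set.Ico 0 (K : ℤ)) N y x = ∅ := by
        refine Set.eq_empty_of_forall_notMem fun X => ?_
        rintro ⟨k, hk, rfl⟩
        have h1 := hk.2 k le_rfl
        refine hx (Finset.mem_map.2 ⟨(X (N + k)).natAbs, ?_, ?_⟩)
        · simp only [Set.mem_Ico] at h1
          simp only [Finset.mem_range]
          omega
        · simp only [Set.mem_Ico] at h1
          rw [he]
          omega
      simp [this]
    rw [tsum_eq_sum hzero, Finset.sum_map]
    refine Finset.sum_le_sum fun k _ => ?_
    rw [tsum_eq_sum (s := Finset.range M) fun j hj => by simp [c, Finset.mem_range.not.1 hj]]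
    have hc : ∑ j ∈ Finset.range M, c (e k) j = ∑ j ∈ Finset.range M, ENNReal.ofReal (drift (ω k j))
        + ∑ j ∈ Finset.range M, excess (ω k j) k := by
      rw [← Finset.sum_add_distrib]
      refine Finset.sum_congr rfl fun j hj => ?_
      simp [c, he, Finset.mem_range.1 hj]
    rw [hc, mul_add]
    refine add_le_add ?_ (mul_le_of_le_one_left zero_le prob_le_one)
    gcongr
    -- Forgetting the upper barrier makes the visiting event independent of `K`.
    rintro X ⟨i, hi, hX⟩
    exact ⟨i, ⟨hi.1, fun m hm => (hi.2 m hm).1⟩, hX.trans (he k)⟩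

lemma escapesLeft_subset_exits {N : ℕ} {y : ℤ} {K : ℕ} (hK : -(K : ℤ) < y) :
    escapesLeft N y ⊆ exits (Set.Ioo (-(K : ℤ)) 0) (Set.Iic (-(K : ℤ))) N y := by
  rintro X ⟨rfl, hneg, hunb⟩
  obtain ⟨n, hn, hX⟩ := hunb K
  obtain ⟨k, hk, hk'⟩ := exists_staysIn_of_notMem (I := Set.Ioo (-(K : ℤ)) 0)
    ⟨hK, hneg N le_rfl⟩ ⟨n, hn, fun h => not_lt.2 hX h.1⟩
  exact ⟨k, hk, not_lt.1 fun h => hk' ⟨h, hneg _ (by omega)⟩⟩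

/-- Staying nonnegative excludes visiting `-1` infinitely often, so the dichotomy leaves only
convergence to `+∞`, which forces a passage above `K`. -/
lemma staysRight_subset_exits {N : ℕ} {y : ℤ} {K : ℕ} (hK : y < K) :
    staysRight N y ∩ (recurrent ∪ transientRight)
      ⊆ exits (Set.Ico 0 (K : ℤ)) (Set.Ici (K : ℤ)) N y := by
  rintro X ⟨⟨rfl, hpos⟩, hX⟩
  have hT : X ∈ transientRight := by
    refine hX.resolve_left fun h => ?_
    obtain ⟨n, hn, hX⟩ := ((Nat.frequently_atTop_iff_infinite.2 (h (-1))).and_eventually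
      (eventually_ge_atTop N)).exists
    have := hpos n hX
    omega
  obtain ⟨n, hn, hX⟩ := ((tendsto_atTop.1 hT K).and (eventually_ge_atTop N)).exists
  obtain ⟨k, hk, hk'⟩ := exists_staysIn_of_notMem (I := Set.Ico 0 (K : ℤ))
    ⟨hpos N le_rfl, hK⟩ ⟨n, hX, fun h => not_lt.2 hn h.2⟩
  exact ⟨k, hk, not_lt.1 fun h => hk' ⟨hpos _ (by omega), h⟩⟩

/-- A path that visits `x` before becoming negative stays nonnegative forever, unless `x` is
one of finitely many sites. -/
lemma eventually_notMem_visits_diff (N : ℕ) (y : ℤ) (X : ℕ → ℤ) :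
    ∀ᶠ k : ℕ in atTop, X ∉ visits (Set.Ici 0) N y k \ staysRight N y := by
  by_cases hX : X N = y ∧ X ∉ staysRight N y
  · obtain ⟨hN, hX⟩ := hX
    obtain ⟨m, hm, hm'⟩ : ∃ m ≥ N, X m < 0 := by
      by_contra! h
      exact hX ⟨hN, h⟩
    obtain ⟨b, hb⟩ := ((Set.finite_Iic m).image X).bddAbove
    filter_upwards [eventually_gt_atTop b.toNat] with k hk
    rintro ⟨⟨i, hi, hik⟩, -⟩
    have h1 : N + i < m := by
      by_contra! h
      have := hi.2 (m - N) (by omega)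
      rw [Nat.add_sub_cancel' hm] at this
      exact absurd this (not_le.2 hm')
    have h2 : X (N + i) ≤ b := hb ⟨N + i, h1.le, rfl⟩
    omega
  · refine Eventually.of_forall fun k h => hX ⟨?_, h.2⟩
    obtain ⟨⟨i, hi, -⟩, -⟩ := h
    exact hi.1

end ExcitedWalk

/-! ### Measurability, stationarity, and the dichotomy for almost every environment. -/

namespace ExcitedWalk

lemma measurableSet_escapesLeft (N : ℕ) (y : ℤ) : MeasurableSet (escapesLeft N y) := by
  have : escapesLeft N y = {X | X N ∈ ({y} : Set ℤ)} ∩ ((⋂ n ≥ N, {X | X n ∈ Set.Iio (0 : ℤ)}) ∩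
      ⋂ K : ℕ, ⋃ n ≥ N, {X | X n ∈ Set.Iic (-(K : ℤ))}) := by
    ext X; simp [escapesLeft]
  rw [this]
  exact (measurableSet_coord _ _).inter
    ((MeasurableSet.biInter (Set.to_countable _) fun n _ => measurableSet_coord _ _).inter
      (MeasurableSet.iInter fun K =>
        MeasurableSet.biUnion (Set.to_countable _) fun n _ => measurableSet_coord _ _))

lemma measurableSet_staysRight (N : ℕ) (y : ℤ) : MeasurableSet (staysRight N y) := by
  have : staysRight N y = {X | X N ∈ ({y} : Set ℤ)} ∩ ⋂ n ≥ N, {X | X n ∈ Set.Ici (0 : ℤ)} := by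
    ext X; simp [staysRight]
  rw [this]
  exact (measurableSet_coord _ _).inter
    (MeasurableSet.biInter (Set.to_countable _) fun n _ => measurableSet_coord _ _)

lemma measurableSet_recurrent : MeasurableSet recurrent := by
  have : recurrent = ⋂ x : ℤ, ⋂ a : ℕ, ⋃ n ≥ a, {X | X n ∈ ({x} : Set ℤ)} := by
    ext X
    simp [recurrent, ← Nat.frequently_atTop_iff_infinite, frequently_atTop]
  rw [this]
  exact MeasurableSet.iInter fun x => MeasurableSet.iInter fun a =>
    MeasurableSet.biUnion (Set.to_countable _) fun n _ => measurableSet_coord _ _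

lemma measurableSet_transientRight : MeasurableSet transientRight := by
  have : transientRight = ⋂ b : ℤ, ⋃ a : ℕ, ⋂ n ≥ a, {X | X n ∈ Set.Ici b} := by
    ext X
    simp [transientRight, tendsto_atTop]
  rw [this]
  exact MeasurableSet.iInter fun x => MeasurableSet.iUnion fun a =>
    MeasurableSet.biInter (Set.to_countable _) fun n _ => measurableSet_coord _ _

lemma measurable_quenchedLaw_apply (x₀ : ℤ) {s : Set (ℕ → ℤ)} (hs : MeasurableSet s) :
    Measurable fun ω : CookieEnv => quenchedLaw ω x₀ s :=
  (Measure.measurable_coe hs).comp (measurable_quenchedLaw x₀)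

lemma measurable_cookie (x : ℤ) (j : ℕ) : Measurable fun ω : CookieEnv => (ω x j : Measure ℤ) := by
  have h1 : Measurable fun ω : CookieEnv => ω x j := by fun_prop
  exact measurable_subtype_coe.comp h1

lemma measurable_lintegral_cookie (x : ℤ) (j : ℕ) (f : ℤ → ℝ≥0∞) :
    Measurable fun ω : CookieEnv => ∫⁻ z, f z ∂(ω x j : Measure ℤ) :=
  (Measure.measurable_lintegral Measurable.of_discrete).comp (measurable_cookie x j)

lemma measurable_drift_cookie (x : ℤ) (j : ℕ) : Measurable fun ω : CookieEnv => drift (ω x j) := by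
  let κ : Kernel CookieEnv ℤ := ⟨fun ω => (ω x j : Measure ℤ), measurable_cookie x j⟩
  have hκ : IsMarkovKernel κ := ⟨fun ω => inferInstanceAs (IsProbabilityMeasure (ω x j : Measure ℤ))⟩
  exact (StronglyMeasurable.integral_kernel (κ := κ) (f := fun z : ℤ => (z : ℝ))
    (Measurable.of_discrete).stronglyMeasurable).measurable

lemma iterate_shift (n : ℕ) (ω : CookieEnv) (x : ℤ) : shift^[n] ω x = ω (x + n) := by
  induction n generalizing ω with
  | zero => simp
  | succ n ih =>
    rw [Function.iterate_succ_apply, ih]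
    simp only [shift]
    congr 1
    push_cast
    ring

variable {η : Measure CookieEnv} {M : ℕ} {μ : ProbabilityMeasure ℤ}

lemma lintegral_comp_site (hη : MeasurePreserving shift η η)
    {φ : (ℕ → ProbabilityMeasure ℤ) → ℝ≥0∞} (hφ : Measurable φ) (x : ℤ) :
    ∫⁻ ω, φ (ω x) ∂η = ∫⁻ ω, φ (ω 0) ∂η := by
  have hm : ∀ x : ℤ, Measurable fun ω : CookieEnv => φ (ω x) := fun x =>
    hφ.comp (measurable_pi_apply x)
  rcases Int.eq_nat_or_neg x with ⟨n, rfl | rfl⟩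
  · rw [← (hη.iterate n).lintegral_comp (hm 0)]
    simp [iterate_shift]
  -- A negative site is moved to the origin by the forward shift, so no inverse of `shift` is
  -- needed.
  · rw [← (hη.iterate n).lintegral_comp (hm (-n))]
    simp [iterate_shift]

/-- The expected number of cookies at a site with a step in a given set, as a measure. -/
noncomputable def cookieIntensity (η : Measure CookieEnv) (M : ℕ) : Measure ℤ :=
  ∑ j ∈ Finset.range M, η.bind fun ω => (ω 0 j : Measure ℤ)

lemma lintegral_sum_cookies (hη : MeasurePreserving shift η η) (f : ℤ → ℝ≥0∞) (x : ℤ) :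
    ∫⁻ ω, ∑ j ∈ Finset.range M, ∫⁻ z, f z ∂(ω x j : Measure ℤ) ∂η
      = ∫⁻ z, f z ∂(cookieIntensity η M) := by
  have hm : Measurable fun c : ℕ → ProbabilityMeasure ℤ =>
      ∑ j ∈ Finset.range M, ∫⁻ z, f z ∂(c j : Measure ℤ) := by
    refine Finset.measurable_sum _ fun j _ => ?_
    exact (Measure.measurable_lintegral Measurable.of_discrete).comp
      (measurable_subtype_coe.comp (measurable_pi_apply j))
  rw [lintegral_comp_site hη hm x, cookieIntensity, lintegral_finsetSum_measure,
    lintegral_finsetSum _ fun j _ => measurable_lintegral_cookie 0 j f]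
  refine Finset.sum_congr rfl fun j _ => ?_
  rw [Measure.lintegral_bind (measurable_cookie 0 j).aemeasurable
    (Measurable.of_discrete).aemeasurable]

lemma lintegral_sum_excess (hη : MeasurePreserving shift η η) (x : ℤ) (k : ℕ) :
    ∫⁻ ω, ∑ j ∈ Finset.range M, excess (ω x j) k ∂η
      = ∫⁻ z : ℤ, (ENNReal.ofReal |(z : ℝ)| - k) ∂(cookieIntensity η M) :=
  lintegral_sum_cookies hη _ x

lemma measurable_sum_excess (x : ℤ) (k : ℕ) :
    Measurable fun ω : CookieEnv => ∑ j ∈ Finset.range M, excess (ω x j) k :=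
  Finset.measurable_sum _ fun j _ => measurable_lintegral_cookie x j _

variable (hη : MeasurePreserving shift η η)
  (hmom : ∫⁻ z : ℤ, ENNReal.ofReal |(z : ℝ)| ∂(cookieIntensity η M) ≠ ∞)

include hη hmom

/-- The expected excesses over the distance `k` have vanishing Cesàro means. -/
lemma exists_sum_lintegral_excess_le {ε : ℝ≥0∞} (hε : ε ≠ 0) : ∃ c : ℝ≥0∞, c ≠ ∞ ∧
    ∀ (K : ℕ) (x : ℕ → ℤ), ∑ k ∈ Finset.range K,
      ∫⁻ ω, ∑ j ∈ Finset.range M, excess (ω (x k) j) k ∂η ≤ c + K * ε := by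
  obtain ⟨c, hc, h⟩ := exists_sum_range_le_of_tendsto_zero
    (fun k => ne_top_of_le_ne_top hmom (lintegral_mono fun z => tsub_le_self))
    (tendsto_lintegral_tsub_natCast Measurable.of_discrete hmom) hε
  refine ⟨c, hc, fun K x => ?_⟩
  simp_rw [lintegral_sum_excess hη]
  exact h K

/-- The event lies in the exit event at every level `-K` below `y`; averaging the quenched bound and
dividing by `K` leaves at most `ε`. -/
lemma ae_quenchedLaw_escapesLeft [IsProbabilityMeasure η] (hM : ∀ᵐ ω ∂η, ω ∈ positiveEnv M μ)
    (hμ0 : μ ∈ meanZero) {B : ℕ} (hB : (μ : Measure ℤ) (Set.Icc (-(B : ℤ)) (B : ℤ)) = 1)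
    (x₀ : ℤ) (N : ℕ) (y : ℤ) : ∀ᵐ ω ∂η, quenchedLaw ω x₀ (escapesLeft N y) = 0 := by
  have hm := measurable_quenchedLaw_apply x₀ (measurableSet_escapesLeft N y)
  refine (lintegral_eq_zero_iff hm).1 (le_zero_iff.1 (le_of_forall_gt_imp_ge_of_dense fun ε hε => ?_))
  obtain ⟨c, hc, hc'⟩ := exists_sum_lintegral_excess_le hη hmom hε.ne'
  refine le_of_eventually_natCast_mul_le (c := ENNReal.ofReal ((B - y : ℤ) : ℝ) + c) (by finiteness) ?_
  filter_upwards [eventually_gt_atTop (-y).toNat] with K hK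
  rw [← lintegral_const_mul _ hm]
  calc ∫⁻ ω, K * quenchedLaw ω x₀ (escapesLeft N y) ∂η
      ≤ ∫⁻ ω, (ENNReal.ofReal ((B - y : ℤ) : ℝ) + ∑ k ∈ Finset.range K,
          ∑ j ∈ Finset.range M, excess (ω (-(k : ℤ)) j) k) ∂η := by
        refine lintegral_mono_ae ?_
        filter_upwards [hM] with ω hω
        refine le_trans ?_ (mul_measure_exits_left_le x₀ hω hμ0 hB N y K)
        gcongr
        exact escapesLeft_subset_exits (by omega)
    _ = ENNReal.ofReal ((B - y : ℤ) : ℝ) + ∑ k ∈ Finset.range K,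
          ∫⁻ ω, ∑ j ∈ Finset.range M, excess (ω (-(k : ℤ)) j) k ∂η := by
        rw [lintegral_add_left measurable_const,
          lintegral_finsetSum _ fun k _ => measurable_sum_excess _ k]
        simp
    _ ≤ _ := by
        rw [add_assoc]
        gcongr
        exact hc' K _

/-- A step `z > 0` crosses the origin from exactly the `z` sites of `[-z, 0)`, so by stationarity
the mean of the sum is at most the first absolute moment. -/
lemma ae_tsum_upcrossing_ne_top : ∀ᵐ ω ∂η, ∑' x : ℤ, ∑' j : ℕ,
    (if x < 0 ∧ j < M then (ω x j : Measure ℤ) (Set.Ici (-x)) else 0) ≠ ∞ := by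
  have hm : ∀ x j, Measurable fun ω : CookieEnv =>
      if x < 0 ∧ j < M then (ω x j : Measure ℤ) (Set.Ici (-x)) else 0 := fun x j => by
    split_ifs
    · exact measurable_env_apply x j _
    · exact measurable_const
  refine (ae_lt_top (Measurable.tsum fun x => Measurable.tsum fun j => hm x j) ?_).mono
    fun ω h => h.ne
  rw [lintegral_tsum fun x => (Measurable.tsum fun j => hm x j).aemeasurable]
  refine ne_top_of_le_ne_top hmom ?_
  let g : ℤ → ℤ → ℝ≥0∞ := fun x => if x < 0 then (Set.Ici (-x)).indicator 1 else 0
  have h1 : ∀ x : ℤ, ∫⁻ ω, ∑' j : ℕ,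
      (if x < 0 ∧ j < M then (ω x j : Measure ℤ) (Set.Ici (-x)) else 0) ∂η
      = ∫⁻ z, g x z ∂(cookieIntensity η M) := by
    intro x
    rw [← lintegral_sum_cookies hη _ x]
    refine lintegral_congr fun ω => ?_
    rw [tsum_eq_sum (s := Finset.range M) fun j hj => by simp [Finset.mem_range.not.1 hj]]
    refine Finset.sum_congr rfl fun j hj => ?_
    by_cases hx : x < 0
    · simp only [hx, Finset.mem_range.1 hj, and_self, if_true, g]
      rw [lintegral_indicator_one MeasurableSet.of_discrete]
    · simp [hx, g]
  simp_rw [h1]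
  rw [← lintegral_tsum fun x => (Measurable.of_discrete).aemeasurable]
  refine lintegral_mono fun z => ?_
  rw [tsum_eq_sum (s := Finset.Ico (-z) 0) fun x hx => ?_]
  · calc ∑ x ∈ Finset.Ico (-z) 0, g x z ≤ ∑ x ∈ Finset.Ico (-z) 0, 1 := by
          refine Finset.sum_le_sum fun x _ => ?_
          by_cases hx : x < 0
          · simp only [g, hx, if_true]
            exact Set.indicator_le_self' (fun _ _ => zero_le) z
          · simp [g, hx]
      _ = ENNReal.ofReal ((z.toNat : ℕ) : ℝ) := by simp
      _ ≤ ENNReal.ofReal |(z : ℝ)| := by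
          refine ENNReal.ofReal_le_ofReal ?_
          have : (z.toNat : ℤ) ≤ |z| := by
            rw [Int.toNat_eq_max]
            exact max_le (le_abs_self z) (abs_nonneg z)
          exact_mod_cast this
  · simp only [Finset.mem_Ico, not_and, not_lt] at hx
    by_cases hx0 : x < 0
    · have : z ∉ Set.Ici (-x) := fun h => by
        have h' : -x ≤ z := h
        exact absurd (hx (by omega)) (not_le.2 hx0)
      simp [g, hx0, this]
    · simp [g, hx0]

theorem ae_ae_recurrent_or_transientRight [IsProbabilityMeasure η]
    (hM : ∀ᵐ ω ∂η, ω ∈ positiveEnv M μ) (hμ0 : μ ∈ meanZero)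
    (hμδ : (μ : Measure ℤ) ≠ Measure.dirac 0)
    (hμB : ∃ B : ℕ, (μ : Measure ℤ) (Set.Icc (-(B : ℤ)) (B : ℤ)) = 1)
    (hμspan : AddSubgroup.closure {z : ℤ | (μ : Measure ℤ) {z} ≠ 0} = ⊤) (x₀ : ℤ) :
    ∀ᵐ ω ∂η, ∀ᵐ X ∂(quenchedLaw ω x₀), X ∈ recurrent ∪ transientRight := by
  obtain ⟨B, hB⟩ := hμB
  have hleft : ∀ᵐ ω ∂η, ∀ N y, quenchedLaw ω x₀ (escapesLeft N y) = 0 :=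
    ae_all_iff.2 fun N => ae_all_iff.2 fun y =>
      ae_quenchedLaw_escapesLeft hη hmom hM hμ0 hB x₀ N y
  filter_upwards [hM, hleft, ae_tsum_upcrossing_ne_top hη hmom] with ω h1 h2 h3
  exact quenched_ae_recurrent_or_transientRight x₀ (fun x j => (h1 x).2 j) hμ0 hμδ ⟨B, hB⟩ hμspan
    h3 h2

end ExcitedWalk

/-! ### Total drift below one rules out transience to the right. -/

namespace ExcitedWalk

/-- The total drift of the first `M` cookies at the origin. -/
noncomputable def siteDrift (M : ℕ) (ω : CookieEnv) : ℝ≥0∞ :=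
  ∑ j ∈ Finset.range M, ENNReal.ofReal (drift (ω 0 j))

lemma measurable_siteDrift (M : ℕ) : Measurable (siteDrift M) :=
  Finset.measurable_sum _ fun j _ => (measurable_drift_cookie 0 j).ennreal_ofReal

lemma siteDrift_iterate_shift (M k : ℕ) (ω : CookieEnv) :
    siteDrift M (shift^[k] ω) = ∑ j ∈ Finset.range M, ENNReal.ofReal (drift (ω k j)) := by
  simp [siteDrift, iterate_shift]

lemma ofReal_drift_le (ν : ProbabilityMeasure ℤ) :
    ENNReal.ofReal (drift ν) ≤ ∫⁻ z : ℤ, ENNReal.ofReal |(z : ℝ)| ∂(ν : Measure ℤ) := by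
  refine (ENNReal.ofReal_le_ofReal (le_abs_self _)).trans ?_
  rw [← Real.norm_eq_abs, ofReal_norm]
  refine (enorm_integral_le_lintegral_enorm _).trans (lintegral_mono fun z => ?_)
  rw [← Real.norm_eq_abs, ofReal_norm]

variable {η : Measure CookieEnv} {M : ℕ} {μ : ProbabilityMeasure ℤ}

lemma lintegral_siteDrift_ne_top (hη : MeasurePreserving shift η η)
    (hmom : ∫⁻ z : ℤ, ENNReal.ofReal |(z : ℝ)| ∂(cookieIntensity η M) ≠ ∞) :
    ∫⁻ ω, siteDrift M ω ∂η ≠ ∞ := by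
  refine ne_top_of_le_ne_top hmom ?_
  rw [← lintegral_sum_cookies hη _ 0]
  exact lintegral_mono fun ω => Finset.sum_le_sum fun j _ => ofReal_drift_le _

lemma lintegral_siteDrift_eq (hη : MeasurePreserving shift η η)
    (hmom : ∫⁻ z : ℤ, ENNReal.ofReal |(z : ℝ)| ∂(cookieIntensity η M) ≠ ∞)
    (hM : ∀ᵐ ω ∂η, ω ∈ positiveEnv M μ) (hμ0 : μ ∈ meanZero) :
    ∫⁻ ω, siteDrift M ω ∂η = ENNReal.ofReal (totalDrift η) := by
  have h1 : ∀ᵐ ω ∂η, ∑' j, drift (ω 0 j) = ∑ j ∈ Finset.range M, drift (ω 0 j) := by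
    filter_upwards [hM] with ω hω
    refine tsum_eq_sum fun j hj => ?_
    rw [(hω 0).2 j (by simpa using hj), hμ0.2]
  have h2 : ∀ᵐ ω ∂η, siteDrift M ω = ENNReal.ofReal (∑ j ∈ Finset.range M, drift (ω 0 j)) := by
    filter_upwards [hM] with ω hω
    rw [siteDrift, ENNReal.ofReal_sum_of_nonneg fun j hj =>
      ((hω 0).1 j (Finset.mem_range.1 hj)).2]
  have h3 : 0 ≤ᵐ[η] fun ω => ∑ j ∈ Finset.range M, drift (ω 0 j) := by
    filter_upwards [hM] with ω hω
    exact Finset.sum_nonneg fun j hj => ((hω 0).1 j (Finset.mem_range.1 hj)).2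
  -- The Bochner integral defaults to `0` without integrability; the finite first moment excludes
  -- this, so the real and extended integrals agree.
  rw [totalDrift, integral_congr_ae h1, integral_eq_lintegral_of_nonneg_ae h3
    (Finset.measurable_sum _ fun j _ => measurable_drift_cookie 0 j).aestronglyMeasurable,
    ← lintegral_congr_ae h2, ENNReal.ofReal_toReal (lintegral_siteDrift_ne_top hη hmom)]

instance (η : Measure CookieEnv) [IsProbabilityMeasure η] (x : ℤ) :
    IsProbabilityMeasure (averagedLaw η x) :=
  ⟨by rw [averagedLaw_apply η x MeasurableSet.univ]; simp⟩

/-- If the total drift per site is less than `1`, the walk a.s. does not stay to the right of the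
origin. -/
lemma lintegral_quenchedLaw_staysRight [IsProbabilityMeasure η] (herg : Ergodic shift η)
    (hmom : ∫⁻ z : ℤ, ENNReal.ofReal |(z : ℝ)| ∂(cookieIntensity η M) ≠ ∞)
    (hM : ∀ᵐ ω ∂η, ω ∈ positiveEnv M μ) (hμ0 : μ ∈ meanZero)
    {B : ℕ} (hB : (μ : Measure ℤ) (Set.Icc (-(B : ℤ)) (B : ℤ)) = 1) (x₀ : ℤ)
    (hRT : ∀ᵐ ω ∂η, ∀ᵐ X ∂(quenchedLaw ω x₀), X ∈ recurrent ∪ transientRight)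
    (hδ : ∫⁻ ω, siteDrift M ω ∂η < 1) (N : ℕ) (y : ℤ) :
    ∫⁻ ω, quenchedLaw ω x₀ (staysRight N y) ∂η = 0 := by
  have hη := herg.toMeasurePreserving
  have hmeasH := measurableSet_staysRight N y
  set g : CookieEnv → ℝ≥0∞ := fun ω => quenchedLaw ω x₀ (staysRight N y)
  let V : ℕ → Set (ℕ → ℤ) := fun k => visits (Set.Ici 0) N y k \ staysRight N y
  let q : ℕ → CookieEnv → ℝ≥0∞ := fun k ω => quenchedLaw ω x₀ (V k)
  have hV : ∀ k, MeasurableSet (V k) := fun k => (measurableSet_visits _ N y k).diff hmeasH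
  have hg : Measurable g := measurable_quenchedLaw_apply x₀ hmeasH
  have hq : ∀ k, Measurable (q k) := fun k => measurable_quenchedLaw_apply x₀ (hV k)
  -- Each path lies in only finitely many `V k`, since it has a finite range before its first
  -- negative time after `N`.
  have hq0 : Tendsto (fun k => ∫⁻ ω, q k ω ∂η) atTop (nhds 0) := by
    simp_rw [q, ← fun k => averagedLaw_apply η x₀ (hV k)]
    have := tendsto_measure_of_ae_tendsto_indicator_of_isFiniteMeasure (μ := averagedLaw η x₀) atTop
      MeasurableSet.empty hV (ae_of_all _ fun X =>
        (eventually_notMem_visits_diff N y X).mono fun k hk => by simpa [V] using hk)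
    simpa using this
  have hD := lintegral_siteDrift_ne_top hη hmom
  set δ := ∫⁻ ω, siteDrift M ω ∂η
  set p := ∫⁻ ω, g ω ∂η
  have hp1 : p ≤ 1 := (lintegral_mono fun ω => prob_le_one).trans (by simp)
  have key : p ≤ δ * p := by
    refine ENNReal.le_of_forall_pos_le_add fun ε hε _ => ?_
    -- One third each for the excess, for visits not followed by staying nonnegative, and for the
    -- ergodic average.
    have hε3 : (ε / 3 : ℝ≥0∞) ≠ 0 := (ENNReal.div_pos (by exact_mod_cast hε.ne') (by simp)).ne'
    have hq0' := tendsto_lintegral_comp_iterate_mul hη (measurable_siteDrift M) hD hq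
      (fun k ω => prob_le_one) hq0
    have hqt : ∀ k, ∫⁻ ω, siteDrift M (shift^[k] ω) * q k ω ∂η ≠ ∞ := fun k => by
      refine ne_top_of_le_ne_top hD ?_
      refine le_of_le_of_eq (lintegral_mono fun ω => mul_le_of_le_one_right zero_le prob_le_one)
        ((hη.iterate k).lintegral_comp (measurable_siteDrift M))
    obtain ⟨c₁, hc₁, h₁⟩ := exists_sum_lintegral_excess_le hη hmom hε3
    obtain ⟨c₂, hc₂, h₂⟩ := exists_sum_range_le_of_tendsto_zero hqt hq0' hε3
    refine le_of_eventually_natCast_mul_le (c := ENNReal.ofReal ((y + B : ℤ) : ℝ) + c₁ + c₂)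
      (by finiteness) ?_
    filter_upwards [herg.eventually_sum_lintegral_mul_le (measurable_siteDrift M) hD hg
      (fun ω => prob_le_one) hε3, eventually_gt_atTop y.toNat] with K h₃ hK
    have hmf : ∀ k, Measurable fun ω => siteDrift M (shift^[k] ω) := fun k =>
      (measurable_siteDrift M).comp (hη.iterate k).measurable
    have hm₁ : ∀ k, Measurable fun ω => siteDrift M (shift^[k] ω) * g ω := fun k => (hmf k).mul hg
    have hm₂ : ∀ k, Measurable fun ω => siteDrift M (shift^[k] ω) * q k ω := fun k =>
      (hmf k).mul (hq k)
    have hm₃ : ∀ k : ℕ, Measurable fun ω => siteDrift M (shift^[k] ω) * g ω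
        + siteDrift M (shift^[k] ω) * q k ω + ∑ j ∈ Finset.range M, excess (ω k j) k := fun k =>
      ((hm₁ k).add (hm₂ k)).add (measurable_sum_excess _ k)
    rw [← lintegral_const_mul _ hg]
    calc ∫⁻ ω, K * g ω ∂η
        ≤ ∫⁻ ω, (ENNReal.ofReal ((y + B : ℤ) : ℝ) + ∑ k ∈ Finset.range K,
            (siteDrift M (shift^[k] ω) * g ω + siteDrift M (shift^[k] ω) * q k ω
              + ∑ j ∈ Finset.range M, excess (ω k j) k)) ∂η := by
          refine lintegral_mono_ae ?_
          filter_upwards [hM, hRT] with ω hω hRTω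
          have h4 : g ω ≤ quenchedLaw ω x₀ (exits (Set.Ico 0 (K : ℤ)) (Set.Ici (K : ℤ)) N y) := by
            refine measure_mono_ae ?_
            filter_upwards [hRTω] with X hX hXH
            exact staysRight_subset_exits (by omega) ⟨hXH, hX⟩
          refine (mul_le_mul_right h4 _).trans
            ((mul_measure_exits_right_le x₀ hω hμ0 hB N y K).trans ?_)
          gcongr with k _
          rw [← siteDrift_iterate_shift, mul_comm, ← mul_add]
          gcongr
          -- Visits to `k` split according to whether the walk stays nonnegative forever; the first
          -- piece is bounded by `g ω`, free of `k`.
          refine le_trans (measure_mono fun X hX => ?_) (measure_union_le _ _)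
          by_cases h : X ∈ staysRight N y
          · exact Or.inl h
          · exact Or.inr ⟨hX, h⟩
      _ = ENNReal.ofReal ((y + B : ℤ) : ℝ) +
            (∑ k ∈ Finset.range K, ∫⁻ ω, siteDrift M (shift^[k] ω) * g ω ∂η
            + ∑ k ∈ Finset.range K, ∫⁻ ω, siteDrift M (shift^[k] ω) * q k ω ∂η
            + ∑ k ∈ Finset.range K, ∫⁻ ω, ∑ j ∈ Finset.range M, excess (ω k j) k ∂η) := by
          rw [lintegral_add_left measurable_const, lintegral_finsetSum _ fun k _ => hm₃ k,
            ← Finset.sum_add_distrib, ← Finset.sum_add_distrib]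
          simp only [lintegral_const, measure_univ, mul_one]
          congr 1
          refine Finset.sum_congr rfl fun k _ => ?_
          rw [lintegral_add_right _ (measurable_sum_excess _ k),
            lintegral_add_right _ (hm₂ k)]
      _ ≤ ENNReal.ofReal ((y + B : ℤ) : ℝ) + (K * (δ * p + ε / 3) + (c₂ + K * (ε / 3))
            + (c₁ + K * (ε / 3))) := by
          gcongr
          · exact h₂ K
          · exact h₁ K _
      _ = ENNReal.ofReal ((y + B : ℤ) : ℝ) + c₁ + c₂
            + K * (δ * p + (ε / 3 + ε / 3 + ε / 3)) := by ring
      _ = _ := by rw [ENNReal.add_thirds]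
  by_contra hp
  refine absurd key (not_le.2 ?_)
  calc δ * p < 1 * p := (ENNReal.mul_lt_mul_iff_left hp (ne_top_of_le_ne_top (by simp) hp1)).2 hδ
    _ = p := one_mul p

lemma transientRight_subset : transientRight ⊆ ⋃ (N : ℕ) (y : ℤ), staysRight N y := by
  intro X hX
  obtain ⟨N, hN⟩ := eventually_atTop.1 (tendsto_atTop.1 hX 0)
  exact Set.mem_iUnion₂.2 ⟨N, X N, rfl, hN⟩

end ExcitedWalk

/-! ### From quenched statements to the averaged law. -/

theorem theorem1p1
    (η : Measure ExcitedWalk.CookieEnv) [IsProbabilityMeasure η]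
    (M : ℕ) (hM : 1 ≤ M) (μ : ProbabilityMeasure ℤ)
    -- the environment is stationary and ergodic
    (herg : Ergodic ExcitedWalk.shift η)
    -- at most `M` cookies per site, with non-negative drift, then steps of law `μ`
    (hμ0 : μ ∈ ExcitedWalk.meanZero)
    (hμδ : (μ : Measure ℤ) ≠ Measure.dirac 0)
    (hη : ∀ᵐ ω ∂η, ω ∈ ExcitedWalk.positiveEnv M μ)
    -- `μ` has bounded support, and its support generates the group `ℤ`
    (hμB : ∃ B : ℕ, (μ : Measure ℤ) (Set.Icc (-(B : ℤ)) (B : ℤ)) = 1)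
    (hμspan : AddSubgroup.closure {z : ℤ | (μ : Measure ℤ) {z} ≠ 0} = ⊤)
    -- the cookies at a site have an integrable total absolute first moment
    (hmom : ∫⁻ ω, ∑ j ∈ Finset.range M,
      ∫⁻ z : ℤ, ENNReal.ofReal |(z : ℝ)| ∂(ω 0 j : Measure ℤ) ∂η < ∞) :
    ExcitedWalk.averagedLaw η 0 (ExcitedWalk.recurrent ∪ ExcitedWalk.transientRight) = 1 ∧
    (ExcitedWalk.totalDrift η < 1 →
      ExcitedWalk.averagedLaw η 0 ExcitedWalk.recurrent = 1) := by
  have hmp := herg.toMeasurePreserving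
  have hmom' : ∫⁻ z : ℤ, ENNReal.ofReal |(z : ℝ)| ∂(ExcitedWalk.cookieIntensity η M) ≠ ∞ := by
    rw [← ExcitedWalk.lintegral_sum_cookies hmp _ 0]
    exact hmom.ne
  have hRT := ExcitedWalk.ae_ae_recurrent_or_transientRight hmp hmom' hη hμ0 hμδ hμB hμspan 0
  have hmR := ExcitedWalk.measurableSet_recurrent
  have hmRT := hmR.union ExcitedWalk.measurableSet_transientRight
  have h1 : ExcitedWalk.averagedLaw η 0
      (ExcitedWalk.recurrent ∪ ExcitedWalk.transientRight) = 1 := by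
    rw [ExcitedWalk.averagedLaw_apply η 0 hmRT,
      lintegral_congr_ae (g := fun _ => 1) (hRT.mono fun ω hω => ?_)]
    · simp
    · exact (prob_compl_eq_zero_iff hmRT).1 hω
  refine ⟨h1, fun hδ => ?_⟩
  obtain ⟨B, hB⟩ := hμB
  have hδ' : ∫⁻ ω, ExcitedWalk.siteDrift M ω ∂η < 1 := by
    rw [ExcitedWalk.lintegral_siteDrift_eq hmp hmom' hη hμ0]
    exact ENNReal.ofReal_lt_one.2 hδ
  have hT : ExcitedWalk.averagedLaw η 0 ExcitedWalk.transientRight = 0 := by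
    refine measure_mono_null ExcitedWalk.transientRight_subset
      (measure_iUnion_null fun N => measure_iUnion_null fun y => ?_)
    rw [ExcitedWalk.averagedLaw_apply η 0 (ExcitedWalk.measurableSet_staysRight N y)]
    exact ExcitedWalk.lintegral_quenchedLaw_staysRight herg hmom' hη hμ0 hB 0 hRT hδ' N y
  refine le_antisymm prob_le_one ?_
  calc (1 : ℝ≥0∞) = _ := h1.symm
    _ ≤ _ := measure_union_le _ _
    _ = _ := by rw [hT, add_zero]
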